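/- Let $m\ge 0$ be an integer and let $L=\mathbb R^{m+3}$, with coordinates $x_0,x_1,\dots,x_{m+2}$ and standard basis $e_0,\dots,e_{m+2}$, carry the quadratic form $q_L(x)=-2x_0x_{m+2}+\sum_{i=1}^{m+1}x_i^2$ of signature $(m+2,1)$. Let $SO_{m+2,1}$ be the group of real matrices of determinant $1$ that preserve $q_L$, and let the Möbius space $N\subset\mathbb P(L)$ be the space of lines on which $q_L$ vanishes. Let $J^2(N,1)$ be the space of second jets of unparameterized curves in $N$, that is, of classes of smooth regular curves $\gamma$ in $N$ at the point $\gamma(0)$, where two curves are identified if they have contact of order two at $0$ after a smooth regular change of parameter fixing $0$; it carries its usual topology and smooth structure (as a quotient of the manifold of second-order velocities of regular curves) and the induced action of $SO_{m+2,1}$. Let $o\in J^2(N,1)$ be the second jet at $t=0$ of the curve $t\mapsto[e_0+te_1+\tfrac{t^2}{2}e_{m+2}]$, and let $P_2\subset SO_{m+2,1}$ be the stabilizer of $o$. Then $P_2$ is a closed subgroup, and its Lie algebra $\{X : \exp(tX)\in P_2 \text{ for all } t\in\mathbb R\}$ is \[ \mathfrak p_2=\left\{\begin{pmatrix} h & y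 & 0 & 0\\ 0&0&0&y\\ 0&0&r&0\\ 0&0&0&-h\end{pmatrix} : h,y\in\mathbb R,\ r\in\mathfrak{so}_m\right\} \] (blocks of sizes $1,1,m,1$). The space $J^2(N,1)$ is the homogeneous space $SO_{m+2,1}/P_2$: the map $gP_2\mapsto g\cdot o$ is an $SO_{m+2,1}$-equivariant diffeomorphism $SO_{m+2,1}/P_2\to J^2(N,1)$, that is, an equivariant homeomorphism under which the smooth real functions on open sets correspond in both directions. -/

import Mathlib

open Filter Topology
open scoped ContDiff LinearAlgebra.Projectivization

namespace ConformalJets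

/-! ### Lorentzian space, the group `SO(m+2,1)` and the Möbius space -/

/-- Indices of the coordinates of `ℝ^(m+3)`, in the block form `1 + 1 + m + 1`:
`x₀`, then `x₁`, then `x₂, …, x_{m+1}`, then `x_{m+2}`. -/
abbrev Idx (m : ℕ) : Type := Unit ⊕ Unit ⊕ Fin m ⊕ Unit

/-- The index `0`. -/
abbrev i0 (m : ℕ) : Idx m := .inl ()
/-- The index `1`. -/
abbrev i1 (m : ℕ) : Idx m := .inr (.inl ())
/-- The indices `2, …, m+1`. -/
abbrev iMid {m : ℕ} (k : Fin m) : Idx m := .inr (.inr (.inl k))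
/-- The index `m+2`. -/
abbrev iLast (m : ℕ) : Idx m := .inr (.inr (.inr ()))

/-- The space `L = ℝ^(m+3)`. -/
abbrev Lor (m : ℕ) : Type := Idx m → ℝ

/-- The quadratic form `-2 x₀ x_{m+2} + x₁² + ⋯ + x_{m+1}²`, of signature `(m+2,1)`. -/
def qL {m : ℕ} (x : Lor m) : ℝ :=
  -2 * x (i0 m) * x (iLast m) + (x (i1 m) ^ 2 + ∑ k : Fin m, x (iMid k) ^ 2)

theorem qL_smul {m : ℕ} (a : ℝ) (x : Lor m) : qL (a • x) = a ^ 2 * qL x := by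
  simp only [qL, Pi.smul_apply, smul_eq_mul, mul_pow, ← Finset.mul_sum]
  ring

/-- `SO(m+2,1)`: the real matrices of determinant one that preserve the quadratic form. -/
def SO (m : ℕ) : Subgroup (Matrix.SpecialLinearGroup (Idx m) ℝ) where
  carrier := {A | ∀ x : Lor m, qL (A.1.mulVec x) = qL x}
  one_mem' := by intro x; simp
  mul_mem' := by
    intro A B hA hB x
    have h : (A * B).1.mulVec x = A.1.mulVec (B.1.mulVec x) := by
      simp [Matrix.mulVec_mulVec]
    rw [h, hA, hB]
  inv_mem' := by
    intro A hA x
    have h : A.1.mulVec ((A⁻¹).1.mulVec x) = x := by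
      have h1 : A.1 * (A⁻¹).1 = 1 := by
        rw [← Matrix.SpecialLinearGroup.coe_mul, mul_inv_cancel, Matrix.SpecialLinearGroup.coe_one]
      rw [Matrix.mulVec_mulVec, h1, Matrix.one_mulVec]
    rw [← hA, h]

/-- The matrix of an element of `SO(m+2,1)`. -/
def mat {m : ℕ} (g : SO m) : Matrix (Idx m) (Idx m) ℝ := g.1.1

theorem qL_mulVec {m : ℕ} (g : SO m) (x : Lor m) : qL ((mat g).mulVec x) = qL x := g.2 x

theorem mat_one {m : ℕ} : mat (1 : SO m) = 1 := rfl

theorem mat_mul {m : ℕ} (g h : SO m) : mat (g * h) = (mat g) * (mat h) := rfl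

theorem mat_injective {m : ℕ} (g : SO m) : Function.Injective (mat g).mulVecLin := by
  intro x y hxy
  have h1 : (mat g⁻¹) * (mat g) = 1 := by rw [← mat_mul, inv_mul_cancel, mat_one]
  have h2 : (mat g⁻¹).mulVec ((mat g).mulVec x) = (mat g⁻¹).mulVec ((mat g).mulVec y) := by
    simpa using congrArg (mat g⁻¹).mulVec hxy
  simpa [Matrix.mulVec_mulVec, h1] using h2

/-- The Möbius space: the light-like points of the projective space of `L`. -/
def Moebius (m : ℕ) : Type := {p : ℙ ℝ (Lor m) // qL p.rep = 0}

theorem qL_rep_mk {m : ℕ} (v : Lor m) (hv : v ≠ 0) :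
    qL (Projectivization.mk ℝ v hv).rep = 0 ↔ qL v = 0 := by
  obtain ⟨a, ha⟩ := Projectivization.exists_smul_eq_mk_rep ℝ v hv
  rw [← ha, Units.smul_def, qL_smul]
  simp

/-- The projective action of `SO(m+2,1)` on the Möbius space. -/
noncomputable instance (m : ℕ) : MulAction (SO m) (Moebius m) where
  smul g p := ⟨Projectivization.map (mat g).mulVecLin (mat_injective g) p.1, by
    obtain ⟨p, hp⟩ := p
    induction p using Projectivization.ind with
    | h v hv =>
      rw [qL_rep_mk] at hp
      simp only [Projectivization.map_mk]
      rw [qL_rep_mk, Matrix.mulVecLin_apply, qL_mulVec, hp]⟩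
  one_smul p := by
    obtain ⟨p, hp⟩ := p
    apply Subtype.ext
    change Projectivization.map (mat (1 : SO m)).mulVecLin (mat_injective _) p = p
    induction p using Projectivization.ind with
    | h v hv => simp [Projectivization.map_mk, mat_one]
  mul_smul g h p := by
    obtain ⟨p, hp⟩ := p
    apply Subtype.ext
    change Projectivization.map (mat (g * h)).mulVecLin (mat_injective _) p =
      Projectivization.map (mat g).mulVecLin (mat_injective _)
        (Projectivization.map (mat h).mulVecLin (mat_injective _) p)
    induction p using Projectivization.ind with
    | h v hv => simp [Projectivization.map_mk, mat_mul, Matrix.mulVec_mulVec]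

theorem Moebius.smul_val {m : ℕ} (g : SO m) (p : Moebius m) :
    (g • p).1 = Projectivization.map (mat g).mulVecLin (mat_injective g) p.1 := rfl

/-! ### Second jets of unparameterized curves -/

/-- Smoothness on some neighbourhood of `0 ∈ ℝ`. -/
def SmoothNear {E : Type*} [NormedAddCommGroup E] [NormedSpace ℝ E] (c : ℝ → E) : Prop :=
  ∀ᶠ t in 𝓝 (0 : ℝ), ContDiffAt ℝ ∞ c t

/-- `c` is, near `0`, a smooth lift to `L \ {0}` of the curve `γ` in the Möbius space. -/
def IsLift {m : ℕ} (c : ℝ → Lor m) (γ : ℝ → Moebius m) : Prop :=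
  SmoothNear c ∧ ∀ᶠ t in 𝓝 (0 : ℝ), ∃ h : c t ≠ 0, Projectivization.mk ℝ (c t) h = (γ t).1

/-- A curve in the Möbius space that is, near the parameter value `0`, smooth (that is, it has a
smooth lift to `L \ {0}`) and regular at `0` (the derivative of the lift is not tangent to the line
that the lift spans, so that it represents a nonzero tangent vector of the Möbius space). -/
structure RegCurve (m : ℕ) where
  /-- the parametrization -/
  toFun : ℝ → Moebius m
  regular : ∃ c : ℝ → Lor m, IsLift c toFun ∧ LinearIndependent ℝ ![c 0, deriv c 0]

/-- A smooth regular change of parameter near `0` that fixes `0`. -/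
def IsReparam (φ : ℝ → ℝ) : Prop := SmoothNear φ ∧ φ 0 = 0 ∧ deriv φ 0 ≠ 0

/-- Contact of order two at the parameter value `0`, up to a change of parameter: after
reparametrization the two curves have lifts that agree to second order. -/
def Contact {m : ℕ} (γ₁ γ₂ : RegCurve m) : Prop :=
  ∃ (c₁ c₂ : ℝ → Lor m) (φ : ℝ → ℝ), IsLift c₁ γ₁.toFun ∧ IsLift c₂ γ₂.toFun ∧ IsReparam φ ∧
    (fun t => c₁ t - c₂ (φ t)) =o[𝓝 0] fun t => t ^ 2

theorem IsReparam.tendsto {φ : ℝ → ℝ} (h : IsReparam φ) : Tendsto φ (𝓝 0) (𝓝 0) := by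
  have := h.1.self_of_nhds.continuousAt.tendsto
  rwa [h.2.1] at this

theorem IsReparam.isBigO {φ : ℝ → ℝ} (h : IsReparam φ) :
    (fun t => φ t ^ 2) =O[𝓝 0] fun t => t ^ 2 := by
  have hd : DifferentiableAt ℝ φ 0 := h.1.self_of_nhds.differentiableAt (by simp)
  have := hd.isBigO_sub
  simp only [h.2.1, sub_zero] at this
  exact this.pow 2

theorem SmoothNear.comp {E : Type*} [NormedAddCommGroup E] [NormedSpace ℝ E] {c : ℝ → E}
    {φ : ℝ → ℝ} (hc : SmoothNear c) (h : IsReparam φ) : SmoothNear (fun t => c (φ t)) := by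
  filter_upwards [h.tendsto.eventually hc, h.1] with t h1 h2
  exact ContDiffAt.comp (g := c) (f := φ) t h1 h2

theorem IsReparam.comp {φ ψ : ℝ → ℝ} (hψ : IsReparam ψ) (hφ : IsReparam φ) :
    IsReparam (fun t => ψ (φ t)) := by
  refine ⟨hψ.1.comp hφ, by simp [hφ.2.1, hψ.2.1], ?_⟩
  have h1 : DifferentiableAt ℝ φ 0 := hφ.1.self_of_nhds.differentiableAt (by simp)
  have h2 : DifferentiableAt ℝ ψ (φ 0) := by
    rw [hφ.2.1]; exact hψ.1.self_of_nhds.differentiableAt (by simp)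
  have := deriv_comp (h₂ := ψ) (h := φ) (0 : ℝ) h2 h1
  rw [Function.comp_def] at this
  rw [this, hφ.2.1]
  exact mul_ne_zero hψ.2.2 hφ.2.2

theorem IsReparam.id : IsReparam (fun t => t) :=
  ⟨Eventually.of_forall fun _ => contDiffAt_id, rfl, by simp⟩

theorem IsReparam.exists_inverse {φ : ℝ → ℝ} (h : IsReparam φ) :
    ∃ ψ, IsReparam ψ ∧ ∀ᶠ t in 𝓝 (0 : ℝ), φ (ψ t) = t := by
  have h0 := h.1.self_of_nhds
  have hs : HasStrictDerivAt φ (deriv φ 0) 0 := h0.hasStrictDerivAt (by simp)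
  let e := (hs.hasStrictFDerivAt_equiv h.2.2).toOpenPartialHomeomorph φ
  have he : ∀ t, e t = φ t := fun t => rfl
  have hmem : (0 : ℝ) ∈ e.source :=
    (hs.hasStrictFDerivAt_equiv h.2.2).mem_toOpenPartialHomeomorph_source
  have htm : (0 : ℝ) ∈ e.target := by
    have := e.map_source hmem
    rwa [he, h.2.1] at this
  have hs0 : e.symm 0 = 0 := by
    have := e.left_inv hmem
    rwa [he, h.2.1] at this
  have hright : ∀ᶠ t in 𝓝 (0 : ℝ), φ (e.symm t) = t := by
    filter_upwards [e.open_target.mem_nhds htm] with t ht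
    exact e.right_inv ht
  have hcont : Tendsto e.symm (𝓝 0) (𝓝 0) := by
    have := (e.continuousAt_symm htm).tendsto
    rwa [hs0] at this
  have hder : ∀ᶠ t in 𝓝 (0 : ℝ), deriv φ t ≠ 0 := by
    have hc : ContinuousAt (deriv φ) 0 := by
      exact ((h0.fderiv_right (m := 0) (by simp)).clm_apply
        (contDiffAt_const (c := (1 : ℝ)))).continuousAt
    exact hc.eventually_ne h.2.2
  have hsm : SmoothNear e.symm := by
    filter_upwards [hcont.eventually h.1, hcont.eventually hder, e.open_target.mem_nhds htm]
      with t h1 h2 h3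
    exact e.contDiffAt_symm_deriv h2 h3 (h1.differentiableAt (by simp)).hasDerivAt h1
  refine ⟨e.symm, ⟨hsm, hs0, ?_⟩, hright⟩
  intro hz
  have hd1 : HasDerivAt e.symm 0 0 := by
    have := (hsm.self_of_nhds.differentiableAt (by simp)).hasDerivAt
    rwa [hz] at this
  have hd2 : HasDerivAt φ (deriv φ 0) (e.symm 0) := by rw [hs0]; exact hs.hasDerivAt
  have h3 := (hd2.comp (0 : ℝ) hd1).congr_of_eventuallyEq (f₁ := fun t => t)
    (hright.mono fun t ht => ht.symm)
  have := h3.unique (hasDerivAt_id' (0 : ℝ))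
  simp at this

/-- Two lifts of a curve differ by a smooth nowhere vanishing factor. -/
theorem IsLift.exists_factor {m : ℕ} {c c' : ℝ → Lor m} {γ : ℝ → Moebius m}
    (h : IsLift c γ) (h' : IsLift c' γ) :
    ∃ a : ℝ → ℝ, SmoothNear a ∧ (∀ᶠ t in 𝓝 (0 : ℝ), a t ≠ 0) ∧
      ∀ᶠ t in 𝓝 (0 : ℝ), c t = a t • c' t := by
  obtain ⟨h0, -⟩ := h'.2.self_of_nhds
  obtain ⟨i, hi⟩ := Function.ne_iff.1 h0
  simp only [Pi.zero_apply] at hi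
  have hc' : ContinuousAt (fun t => c' t i) 0 :=
    (continuous_apply i).continuousAt.comp h'.1.self_of_nhds.continuousAt
  have hne : ∀ᶠ t in 𝓝 (0 : ℝ), c' t i ≠ 0 := hc'.eventually_ne hi
  have hkey : ∀ᶠ t in 𝓝 (0 : ℝ), c t i / c' t i ≠ 0 ∧ c t = (c t i / c' t i) • c' t := by
    filter_upwards [h.2, h'.2, hne] with t ⟨h1, e1⟩ ⟨h2, e2⟩ h3
    obtain ⟨b, hb⟩ := (Projectivization.mk_eq_mk_iff' ℝ _ _ h1 h2).1 (e1.trans e2.symm)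
    have hbi : c t i / c' t i = b := by
      rw [← hb]; simp [h3]
    rw [hbi]
    refine ⟨?_, hb.symm⟩
    rintro rfl
    exact h1 (by rw [← hb, zero_smul])
  refine ⟨fun t => c t i / c' t i, ?_, hkey.mono fun _ h => h.1, hkey.mono fun _ h => h.2⟩
  filter_upwards [h.1, h'.1, hne] with t h1 h2 h3
  exact (contDiffAt_pi.1 h1 i).div (contDiffAt_pi.1 h2 i) h3

theorem Contact.refl {m : ℕ} (γ : RegCurve m) : Contact γ γ := by
  obtain ⟨c, hc, -⟩ := γ.regular
  exact ⟨c, c, fun t => t, hc, hc, IsReparam.id, by simp⟩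

theorem Contact.symm {m : ℕ} {γ₁ γ₂ : RegCurve m} (h : Contact γ₁ γ₂) : Contact γ₂ γ₁ := by
  obtain ⟨c₁, c₂, φ, h₁, h₂, hφ, ho⟩ := h
  obtain ⟨ψ, hψ, hi⟩ := hφ.exists_inverse
  refine ⟨c₂, c₁, ψ, h₂, h₁, hψ, ?_⟩
  have h3 := (ho.comp_tendsto hψ.tendsto).trans_isBigO hψ.isBigO
  refine (h3.neg_left).congr' ?_ EventuallyEq.rfl
  filter_upwards [hi] with t ht
  simp [ht]

theorem Contact.trans {m : ℕ} {γ₁ γ₂ γ₃ : RegCurve m} (h : Contact γ₁ γ₂) (h' : Contact γ₂ γ₃) :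
    Contact γ₁ γ₃ := by
  obtain ⟨c₁, c₂, φ, h₁, h₂, hφ, ho⟩ := h
  obtain ⟨d₂, d₃, ψ, k₂, k₃, hψ, ko⟩ := h'
  obtain ⟨a, ha, hne, heq⟩ := h₂.exists_factor k₂
  have haφ : SmoothNear (fun t => a (φ t)) := ha.comp hφ
  have hneφ : ∀ᶠ t in 𝓝 (0 : ℝ), a (φ t) ≠ 0 := hφ.tendsto.eventually hne
  have hinv : SmoothNear (fun t => (a (φ t))⁻¹) := by
    filter_upwards [haφ, hneφ] with t h1 h2
    exact h1.inv h2
  refine ⟨fun t => (a (φ t))⁻¹ • c₁ t, d₃, fun t => ψ (φ t), ⟨?_, ?_⟩, k₃, hψ.comp hφ, ?_⟩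
  · filter_upwards [hinv, h₁.1] with t u1 u2
    exact u1.smul u2
  · filter_upwards [h₁.2, hneφ] with t ⟨u1, u2⟩ u3
    refine ⟨smul_ne_zero (inv_ne_zero u3) u1, ?_⟩
    rw [← u2, Projectivization.mk_eq_mk_iff']
    exact ⟨_, rfl⟩
  · have o1 : (fun t => (a (φ t))⁻¹ • (c₁ t - c₂ (φ t))) =o[𝓝 0] fun t : ℝ => t ^ 2 := by
      have hb : (fun t => (a (φ t))⁻¹) =O[𝓝 0] fun _ : ℝ => (1 : ℝ) :=
        hinv.self_of_nhds.continuousAt.tendsto.isBigO_one ℝ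
      simpa using hb.smul_isLittleO ho
    have o2 := (ko.comp_tendsto hφ.tendsto).trans_isBigO hφ.isBigO
    refine (o1.add o2).congr' ?_ EventuallyEq.rfl
    filter_upwards [hφ.tendsto.eventually heq, hneφ] with t u1 u2
    simp only [Function.comp_apply, u1, smul_sub, smul_smul, inv_mul_cancel₀ u2, one_smul]
    abel

/-- Second-order contact as an equivalence relation. -/
instance contactSetoid (m : ℕ) : Setoid (RegCurve m) where
  r := Contact
  iseqv := ⟨Contact.refl, Contact.symm, Contact.trans⟩

/-- The space of second jets of unparameterized curves in the Möbius space. -/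
def J2 (m : ℕ) : Type := Quotient (contactSetoid m)

/-- The second jet at the parameter value `0` of (the unparameterized curve traced by) `γ`. -/
def RegCurve.jet {m : ℕ} (γ : RegCurve m) : J2 m := Quotient.mk _ γ

theorem IsLift.smul {m : ℕ} {c : ℝ → Lor m} {γ : ℝ → Moebius m} (h : IsLift c γ) (g : SO m) :
    IsLift (fun t => (mat g).mulVec (c t)) (fun t => g • γ t) := by
  constructor
  · filter_upwards [h.1] with t ht
    exact (LinearMap.toContinuousLinearMap (mat g).mulVecLin).contDiff.contDiffAt.comp t ht
  · filter_upwards [h.2] with t ⟨h1, h2⟩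
    refine ⟨fun h0 => h1 ((mat_injective g) (by simpa using h0)), ?_⟩
    rw [Moebius.smul_val, ← h2, Projectivization.map_mk]
    rfl

/-- The action of `SO(m+2,1)` on curves in the Möbius space. -/
noncomputable instance (m : ℕ) : MulAction (SO m) (RegCurve m) where
  smul g γ := ⟨fun t => g • γ.toFun t, by
    obtain ⟨c, hc, hl⟩ := γ.regular
    refine ⟨_, hc.smul g, ?_⟩
    have hd : HasDerivAt c (deriv c 0) 0 :=
      (hc.1.self_of_nhds.differentiableAt (by simp)).hasDerivAt
    have hd' := ((LinearMap.toContinuousLinearMap (mat g).mulVecLin).hasFDerivAt.comp_hasDerivAt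
      (0 : ℝ) hd).deriv
    have h2 := hl.map' (mat g).mulVecLin (LinearMap.ker_eq_bot.2 (mat_injective g))
    have h3 : (mat g).mulVecLin ∘ ![c 0, deriv c 0] =
        ![(mat g).mulVec (c 0), deriv (fun t => (mat g).mulVec (c t)) 0] := by
      funext j
      fin_cases j
      · rfl
      · exact hd'.symm
    rwa [h3] at h2⟩
  one_smul γ := by
    cases γ with
    | mk f hf =>
      change RegCurve.mk _ _ = _
      congr 1
      funext t
      exact one_smul _ _
  mul_smul g h γ := by
    cases γ with
    | mk f hf =>
      change RegCurve.mk _ _ = RegCurve.mk _ _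
      congr 1
      funext t
      exact mul_smul _ _ _

theorem Contact.smul {m : ℕ} {γ₁ γ₂ : RegCurve m} (h : Contact γ₁ γ₂) (g : SO m) :
    Contact (g • γ₁) (g • γ₂) := by
  obtain ⟨c₁, c₂, φ, h₁, h₂, hφ, ho⟩ := h
  refine ⟨_, _, φ, h₁.smul g, h₂.smul g, hφ, ?_⟩
  have hb := (LinearMap.toContinuousLinearMap (mat g).mulVecLin).isBigO_comp
    (fun t => c₁ t - c₂ (φ t)) (𝓝 (0 : ℝ))
  refine (hb.trans_isLittleO ho).congr_left fun t => ?_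
  exact Matrix.mulVec_sub (mat g) _ _

/-- The action of `SO(m+2,1)` on second jets: `g` maps the jet of `γ` to the jet of `g • γ`. -/
noncomputable instance (m : ℕ) : MulAction (SO m) (J2 m) where
  smul g := Quotient.map (fun γ => g • γ) fun _ _ h => Contact.smul h g
  one_smul z := Quotient.inductionOn z fun γ => congrArg RegCurve.jet (one_smul (SO m) γ)
  mul_smul g h z := Quotient.inductionOn z fun γ => congrArg RegCurve.jet (mul_smul g h γ)

theorem smul_jet {m : ℕ} (g : SO m) (γ : RegCurve m) : g • γ.jet = (g • γ).jet := rfl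

/-! ### Topology and smooth structure of the jet space -/

/-- Curves in the Möbius space together with a lift. -/
def LiftedCurve (m : ℕ) : Type := {x : RegCurve m × (ℝ → Lor m) // IsLift x.2 x.1.toFun}

/-- The parametrized second-order velocity `(c(0), c'(0), c''(0))` of a lift. The set of these
velocities is a submanifold of `L × L × L`. -/
noncomputable def velocity {m : ℕ} (x : LiftedCurve m) : Lor m × Lor m × Lor m :=
  (x.1.2 0, deriv x.1.2 0, deriv (deriv x.1.2) 0)

/-- The unparameterized second jet of a lifted curve. -/
def liftedJet {m : ℕ} (x : LiftedCurve m) : J2 m := x.1.1.jet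

/-- The jet space carries the quotient topology from the set of second-order velocities. -/
noncomputable instance (m : ℕ) : TopologicalSpace (J2 m) :=
  TopologicalSpace.coinduced liftedJet (TopologicalSpace.induced velocity inferInstance)

/-- Let `ι : S → E` have a submanifold of `E` as its image, and let `X` be a quotient of that
submanifold, with projection `p : S → X`. A function `f` is smooth on an open set `U` of `X` if its
pullback is a smooth function on the part of the submanifold that lies over `U`, that is, if it is
locally the restriction of a smooth function on an open set of `E`. -/
def IsSmoothOn {S X E : Type*} [NormedAddCommGroup E] [NormedSpace ℝ E] (ι : S → E) (p : S → X)
    (U : Set X) (f : X → ℝ) : Prop :=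
  ∀ s, p s ∈ U → ∃ W : Set E, IsOpen W ∧ ι s ∈ W ∧ ∃ F : E → ℝ, ContDiffOn ℝ ∞ F W ∧
    ∀ s', p s' ∈ U → ι s' ∈ W → F (ι s') = f (p s')

/-- The smooth functions on open sets of the jet space, seen as the quotient of the manifold of
second-order velocities by changes of parameter and of lift. -/
noncomputable def J2.SmoothOn {m : ℕ} (U : Set (J2 m)) (f : J2 m → ℝ) : Prop := IsSmoothOn velocity liftedJet U f

/-- The smooth functions on open sets of a homogeneous space of `SO(m+2,1)`, the group being a
submanifold of the space of matrices. -/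
def quotSmoothOn {m : ℕ} (H : Subgroup (SO m)) (U : Set (SO m ⧸ H)) (f : SO m ⧸ H → ℝ) : Prop :=
  IsSmoothOn (fun (g : SO m) (i j : Idx m) => (mat g) i j) (fun g => (g : SO m ⧸ H)) U f

/-! ### The base jet, its stabilizer and the Lie algebra -/

/-- The null curve `e₀ + t e₁ + (t²/2) e_{m+2}`. -/
noncomputable def baseLift (m : ℕ) (t : ℝ) : Lor m
  | .inl _ => 1
  | .inr (.inl _) => t
  | .inr (.inr (.inl _)) => 0
  | .inr (.inr (.inr _)) => t ^ 2 / 2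

theorem baseLift_ne_zero (m : ℕ) (t : ℝ) : baseLift m t ≠ 0 := fun h => by
  have := congrFun h (i0 m)
  simp [baseLift] at this

theorem qL_baseLift (m : ℕ) (t : ℝ) : qL (baseLift m t) = 0 := by
  simp [qL, baseLift]
  ring

theorem contDiff_baseLift (m : ℕ) : ContDiff ℝ ∞ (baseLift m) := by
  rw [contDiff_pi]
  rintro (_ | _ | _ | _) <;> simp only [baseLift] <;> fun_prop

/-- The circle in the Möbius space through `[e₀]` in the direction of `e₁`. -/
noncomputable def baseCurve (m : ℕ) : RegCurve m where
  toFun t := ⟨Projectivization.mk ℝ (baseLift m t) (baseLift_ne_zero m t),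
    (qL_rep_mk _ _).2 (qL_baseLift m t)⟩
  regular := by
    refine ⟨baseLift m, ⟨Eventually.of_forall fun t => (contDiff_baseLift m).contDiffAt,
      Eventually.of_forall fun t => ⟨baseLift_ne_zero m t, rfl⟩⟩, ?_⟩
    have hd : ∀ i, deriv (baseLift m) 0 i = deriv (fun t => baseLift m t i) 0 := fun i =>
      congrFun (deriv_pi fun i => by
        exact (contDiff_pi.1 (contDiff_baseLift m) i).differentiable (by simp) |>.differentiableAt) i
    rw [LinearIndependent.pair_iff]
    intro s t hst
    have h0 := congrFun hst (i0 m)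
    have h1 := congrFun hst (i1 m)
    simp only [Pi.add_apply, Pi.smul_apply, hd, Pi.zero_apply] at h0 h1
    simp [baseLift] at h0 h1
    exact ⟨h0, h1⟩

/-- The second jet of this circle at `[e₀]`. -/
noncomputable def baseJet (m : ℕ) : J2 m := (baseCurve m).jet

/-- The group `P₂`: the stabilizer of the base jet. -/
noncomputable def P2 (m : ℕ) : Subgroup (SO m) := MulAction.stabilizer (SO m) (baseJet m)

/-- The Lie algebra of a (closed) subgroup of `SO(m+2,1)`: the matrices whose one-parameter groups
lie in the subgroup. -/
def lieAlgebraOf {m : ℕ} (H : Subgroup (SO m)) : Set (Matrix (Idx m) (Idx m) ℝ) :=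
  {X | ∀ t : ℝ, ∃ g ∈ H, (mat g) = NormedSpace.exp (t • X)}

/-- The block matrix
```
  h  y  0  0
  0  0  0  y
  0  0  r  0
  0  0  0 -h
```
-/
def p2Matrix {m : ℕ} (h y : ℝ) (r : Matrix (Fin m) (Fin m) ℝ) : Matrix (Idx m) (Idx m) ℝ
  | .inl _, .inl _ => h
  | .inl _, .inr (.inl _) => y
  | .inr (.inl _), .inr (.inr (.inr _)) => y
  | .inr (.inr (.inl i)), .inr (.inr (.inl j)) => r i j
  | .inr (.inr (.inr _)), .inr (.inr (.inr _)) => -h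
  | _, _ => 0

/-- The Lie algebra `𝔭₂`: the matrices above with `h, y` real and `r` in `𝔰𝔬(m)`. -/
def p2 (m : ℕ) : Set (Matrix (Idx m) (Idx m) ℝ) :=
  {X | ∃ (h y : ℝ) (r : Matrix (Fin m) (Fin m) ℝ), r.transpose = -r ∧ X = p2Matrix h y r}

end ConformalJets

namespace ConformalJets

/-! ### The polar form of `qL` and its isometries -/

/-! Differentiating `qL (c t) = 0` twice shows that the velocity `(c, c', c'')` of a lift has a
fixed Gram matrix up to the scale `qL c'` and the components of `c''` along `c'` and itself.
Conversely the unparameterized jet depends only on the flag `⟨c⟩ ⊂ ⟨c, c'⟩ ⊂ ⟨c, c', c''⟩`: changes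
of lift and of parameter absorb all coefficients except one, and the relation `bil c c'' = -qL c'`
fixes that one (`liftedJet_eq_of_velocity`). Gram–Schmidt turns a velocity into a frame with the
inner products of `e₀, e₁, e_{m+2}`.

Reflections carry any such frame to the standard one up to scale, so the action on jets is
transitive (`exists_smul_baseJet_eq`). The stabilizer of the base jet is the group of isometries
preserving the standard flag, a condition cut out by linear equations on the matrix (`mem_P2_iff`).
Hence it is closed, and its Lie algebra consists of the infinitesimal isometries satisfying the same
linear equations.

For the topology and the smooth structure, two maps go between matrices and velocities. The columns
of `g` are the velocity of `g` applied to the base lift, which is linear in `g`. Backwards, a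
product of rotations matching nearby frames gives a smooth local section of the orbit map
(`exists_local_section`). Pulling open sets and smooth functions back along these two maps yields
both directions. -/

/-- The symmetric bilinear form with `bil x x = qL x`. -/
def bil {m : ℕ} : LinearMap.BilinForm ℝ (Lor m) :=
  LinearMap.mk₂ ℝ (fun x y => -(x (i0 m) * y (iLast m) + x (iLast m) * y (i0 m)) +
      (x (i1 m) * y (i1 m) + ∑ k : Fin m, x (iMid k) * y (iMid k)))
    (fun x y z => by simp only [Pi.add_apply, add_mul, Finset.sum_add_distrib]; ring)
    (fun a x y => by simp only [Pi.smul_apply, smul_eq_mul, mul_assoc, ← Finset.mul_sum]; ring)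
    (fun x y z => by simp only [Pi.add_apply, mul_add, Finset.sum_add_distrib]; ring)
    (fun a x y => by
      simp only [Pi.smul_apply, smul_eq_mul, mul_left_comm _ a, ← Finset.mul_sum]; ring)

theorem bil_apply {m : ℕ} (x y : Lor m) :
    bil x y = -(x (i0 m) * y (iLast m) + x (iLast m) * y (i0 m)) +
      (x (i1 m) * y (i1 m) + ∑ k : Fin m, x (iMid k) * y (iMid k)) := rfl

theorem bil_self {m : ℕ} (x : Lor m) : bil x x = qL x := by
  simp only [bil_apply, qL, pow_two]; ring

theorem bil_comm {m : ℕ} (x y : Lor m) : bil x y = bil y x := by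
  simp only [bil_apply, mul_comm]; ring

theorem bil_eq_polar {m : ℕ} (x y : Lor m) : bil x y = (qL (x + y) - qL x - qL y) / 2 := by
  simp only [← bil_self, map_add, LinearMap.add_apply, bil_comm y x]; ring

/-- Matrices that preserve the quadratic form. -/
def IsIsom {m : ℕ} (A : Matrix (Idx m) (Idx m) ℝ) : Prop := ∀ x : Lor m, qL (A.mulVec x) = qL x

theorem IsIsom.bil_eq {m : ℕ} {A : Matrix (Idx m) (Idx m) ℝ} (h : IsIsom A) (x y : Lor m) :
    bil (A.mulVec x) (A.mulVec y) = bil x y := by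
  rw [bil_eq_polar, ← Matrix.mulVec_add, h, h, h, ← bil_eq_polar]

theorem IsIsom.mul {m : ℕ} {A B : Matrix (Idx m) (Idx m) ℝ} (hA : IsIsom A) (hB : IsIsom B) :
    IsIsom (A * B) := fun x => by rw [← Matrix.mulVec_mulVec, hA, hB]

theorem IsIsom.one {m : ℕ} : IsIsom (1 : Matrix (Idx m) (Idx m) ℝ) := fun x => by simp

theorem isIsom_mat {m : ℕ} (g : SO m) : IsIsom (mat g) := g.2

theorem bil_nondegenerate {m : ℕ} : (bil (m := m)).Nondegenerate := by
  have key : ∀ x : Lor m, (∀ y, bil x y = 0) → x = 0 := by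
    intro x hx
    funext i
    rcases i with ⟨⟩ | ⟨⟩ | k | ⟨⟩
    · simpa [bil_apply] using hx (Pi.single (iLast m) 1)
    · simpa [bil_apply] using hx (Pi.single (i1 m) 1)
    · simpa [bil_apply, Pi.single_apply] using hx (Pi.single (iMid k) 1)
    · simpa [bil_apply] using hx (Pi.single (i0 m) 1)
  exact ⟨key, fun y hy => key y fun x => by rw [bil_comm, hy]⟩

/-- Take determinants in `Aᵀ J A = J`, where the Gram matrix `J` of `bil` is invertible. -/
theorem IsIsom.det_sq {m : ℕ} {A : Matrix (Idx m) (Idx m) ℝ} (h : IsIsom A) : A.det ^ 2 = 1 := by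
  have h1 : (bil (m := m)).comp (Matrix.toLin' A) (Matrix.toLin' A) = bil := by
    refine LinearMap.ext₂ fun x y => ?_
    simpa using h.bil_eq x y
  have h2 := congrArg (fun b => (LinearMap.BilinForm.toMatrix' b).det) h1
  simp only [LinearMap.BilinForm.toMatrix'_comp, Matrix.det_mul, LinearMap.toMatrix'_toLin',
    Matrix.det_transpose] at h2
  have h3 : (LinearMap.BilinForm.toMatrix' (bil (m := m))).det ≠ 0 :=
    Matrix.nondegenerate_iff_det_ne_zero.1
      (LinearMap.BilinForm.nondegenerate_toMatrix'_iff.2 bil_nondegenerate)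
  refine mul_right_cancel₀ h3 ?_
  linear_combination h2

/-- The element of `SO(m+2,1)` given by an isometry of determinant one. -/
def IsIsom.toSO {m : ℕ} {A : Matrix (Idx m) (Idx m) ℝ} (h : IsIsom A) (hd : A.det = 1) : SO m :=
  ⟨⟨A, hd⟩, h⟩

theorem IsIsom.mat_toSO {m : ℕ} {A : Matrix (Idx m) (Idx m) ℝ} (h : IsIsom A) (hd : A.det = 1) :
    mat (h.toSO hd) = A := rfl

/-- The reflection in the hyperplane orthogonal to `w`. -/
noncomputable def reflection {m : ℕ} (w : Lor m) : Matrix (Idx m) (Idx m) ℝ :=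
  LinearMap.toMatrix' (LinearMap.id - (2 / qL w) • (bil w).smulRight w)

theorem reflection_mulVec {m : ℕ} (w z : Lor m) :
    (reflection w).mulVec z = z - (2 / qL w * bil w z) • w := by
  rw [reflection, LinearMap.toMatrix'_mulVec]
  simp [smul_smul]

theorem isIsom_reflection {m : ℕ} {w : Lor m} (hw : qL w ≠ 0) : IsIsom (reflection w) := by
  intro z
  rw [reflection_mulVec]
  simp only [← bil_self, map_sub, map_smul, LinearMap.sub_apply, LinearMap.smul_apply, smul_eq_mul,
    bil_comm z w]
  rw [← bil_self] at hw
  field_simp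
  ring

/-- For vectors of equal square, `qL (x - y) = 2 * bil (x - y) x`, so the reflection in `x - y`
sends `x` to `y`; it fixes everything orthogonal to `x - y`. The only obstruction is a nonzero
light-like difference. -/
theorem exists_isIsom_mulVec_eq {m : ℕ} {x y : Lor m} (hq : qL x = qL y)
    (h : x = y ∨ qL (x - y) ≠ 0) :
    ∃ A, IsIsom A ∧ A.mulVec x = y ∧ ∀ w, bil x w = bil y w → A.mulVec w = w := by
  rcases h with rfl | h
  · exact ⟨1, IsIsom.one, by simp, by simp⟩
  · refine ⟨reflection (x - y), isIsom_reflection h, ?_, fun w hw => ?_⟩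
    · rw [reflection_mulVec]
      have h1 : 2 / qL (x - y) * bil (x - y) x = 1 := by
        rw [div_mul_eq_mul_div, div_eq_one_iff_eq h]
        simp only [← bil_self, map_sub, LinearMap.sub_apply, bil_comm y x] at hq ⊢
        linarith
      rw [h1, one_smul, sub_sub_cancel]
    · simp [reflection_mulVec, hw]

/-- The rotation in the plane of `x` and `y` that maps `x` to `y`; here `qL x = qL y`. -/
noncomputable def rotation {m : ℕ} (x y : Lor m) : Matrix (Idx m) (Idx m) ℝ :=
  LinearMap.toMatrix' (LinearMap.id - (qL x + bil x y)⁻¹ • (bil (x + y)).smulRight (x + y) +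
    (2 / qL x) • (bil x).smulRight y)

theorem rotation_mulVec {m : ℕ} (x y z : Lor m) :
    (rotation x y).mulVec z =
      z - ((qL x + bil x y)⁻¹ * bil (x + y) z) • (x + y) + (2 / qL x * bil x z) • y := by
  rw [rotation, LinearMap.toMatrix'_mulVec]
  simp [smul_smul, -map_add]

theorem rotation_mulVec_left {m : ℕ} {x y : Lor m} (hx : qL x ≠ 0) (hxy : qL x + bil x y ≠ 0) :
    (rotation x y).mulVec x = y := by
  have h1 : bil (x + y) x = qL x + bil x y := by
    rw [map_add, LinearMap.add_apply, bil_self, bil_comm y]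
  rw [rotation_mulVec, h1, bil_self, inv_mul_cancel₀ hxy, div_mul_cancel₀ _ hx]
  module

theorem rotation_mulVec_of_orthogonal {m : ℕ} {x y z : Lor m} (hx : bil x z = 0)
    (hy : bil y z = 0) : (rotation x y).mulVec z = z := by
  simp [rotation_mulVec, hx, hy]

/-- When `qL x = qL y`, the scalar `qL x + bil x y` is half of `qL (x + y)`, and `rotation x y` is
the reflection in `x` followed by the reflection in `x + y`. The formula is checked directly. -/
theorem isIsom_rotation {m : ℕ} {x y : Lor m} (hq : qL x = qL y) (hx : qL x ≠ 0)
    (hxy : qL x + bil x y ≠ 0) : IsIsom (rotation x y) := by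
  intro z
  rw [rotation_mulVec]
  simp only [← bil_self] at *
  simp only [map_sub, map_add, map_smul, LinearMap.sub_apply, LinearMap.add_apply,
    LinearMap.smul_apply, smul_eq_mul, bil_comm z x, bil_comm z y, bil_comm y x, ← hq]
  field_simp
  ring

/-- This is the advantage over a single reflection: the reflection in `x - y` degenerates at `y =
x`, whereas the rotation is regular there and equals the identity. -/
theorem rotation_self {m : ℕ} {x : Lor m} (hx : qL x ≠ 0) : rotation x x = 1 := by
  refine Matrix.ext_of_mulVec_single fun i => ?_
  rw [rotation_mulVec, Matrix.one_mulVec, bil_self, map_add, LinearMap.add_apply]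
  set s := bil x (Pi.single i 1)
  have : (qL x + qL x)⁻¹ * (s + s) = (1 / qL x) * s := by field_simp
  rw [this]
  module

/-! ### Vectors in Lorentzian space -/

theorem sum_sq_eq_zero {m : ℕ} {x : Fin m → ℝ} {s : ℝ} (h : s ^ 2 + ∑ k, x k ^ 2 ≤ 0) :
    s = 0 ∧ ∀ k, x k = 0 := by
  have h1 : 0 ≤ ∑ k, x k ^ 2 := Finset.sum_nonneg fun k _ => sq_nonneg _
  have h2 : ∑ k, x k ^ 2 = 0 := by nlinarith [sq_nonneg s]
  refine ⟨by nlinarith [sq_nonneg s], fun k => ?_⟩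
  have := (Finset.sum_eq_zero_iff_of_nonneg fun k _ => sq_nonneg (x k)).1 h2 k (Finset.mem_univ k)
  simpa using this

/-- The basis vector `e₀`. -/
def e0 (m : ℕ) : Lor m := Pi.single (i0 m) 1
/-- The basis vector `e₁`. -/
def e1 (m : ℕ) : Lor m := Pi.single (i1 m) 1
/-- The basis vector `e_{m+2}`. -/
def eLast (m : ℕ) : Lor m := Pi.single (iLast m) 1

theorem bil_e0 {m : ℕ} (x : Lor m) : bil (e0 m) x = -x (iLast m) := by simp [bil_apply, e0]
theorem bil_e1 {m : ℕ} (x : Lor m) : bil (e1 m) x = x (i1 m) := by simp [bil_apply, e1]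
theorem bil_eLast {m : ℕ} (x : Lor m) : bil (eLast m) x = -x (i0 m) := by
  simp [bil_apply, eLast]

theorem qL_e0 (m : ℕ) : qL (e0 m) = 0 := by rw [← bil_self, bil_e0]; simp [e0]
theorem qL_e1 (m : ℕ) : qL (e1 m) = 1 := by rw [← bil_self, bil_e1]; simp [e1]
theorem qL_eLast (m : ℕ) : qL (eLast m) = 0 := by rw [← bil_self, bil_eLast]; simp [eLast]

/-- A vector on which `qL` is not positive and whose last coordinate vanishes is a multiple of
`e₀`. -/
theorem eq_smul_e0 {m : ℕ} {x : Lor m} (hq : qL x ≤ 0) (hx : x (iLast m) = 0) :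
    x = x (i0 m) • e0 m := by
  rw [qL, hx, mul_zero, zero_add] at hq
  obtain ⟨h1, h2⟩ := sum_sq_eq_zero hq
  funext i
  rcases i with ⟨⟩ | ⟨⟩ | k | ⟨⟩
  · simp [e0]
  · simpa [e0] using h1
  · simpa [e0] using h2 k
  · simpa [e0] using hx

/-- A vector orthogonal to a light-like vector `a` is space-like or a multiple of `a`. -/
theorem qL_pos_of_orthogonal {m : ℕ} {a b : Lor m} (ha : qL a = 0) (hab : bil a b = 0)
    (hi : LinearIndependent ℝ ![a, b]) : 0 < qL b := by
  by_contra hb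
  push Not at hb
  have ha0 : a ≠ 0 := by simpa using hi.ne_zero 0
  rw [LinearIndependent.pair_iff' ha0] at hi
  by_cases hl : a (iLast m) = 0
  · have h1 := eq_smul_e0 ha.le hl
    have h0 : a (i0 m) ≠ 0 := fun h => ha0 (by rw [h1, h, zero_smul])
    have h2 : b (iLast m) = 0 := by
      rw [h1, map_smul, LinearMap.smul_apply, bil_e0] at hab
      simpa [h0] using hab
    have h3 := eq_smul_e0 hb h2
    apply hi (b (i0 m) / a (i0 m))
    rw [h1, h3, smul_smul]
    simp [e0, h0]
  -- Subtracting `s • a` makes the last coordinate vanish and changes neither `qL b` nor the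
  -- orthogonality to `a`. The difference is then a multiple of `e₀`, and as `a` is not orthogonal
  -- to `e₀` the multiple is zero.
  · set s := b (iLast m) / a (iLast m)
    have hw : (b - s • a) (iLast m) = 0 := by simp [s, hl]
    have hq : qL (b - s • a) ≤ 0 := by
      rw [← bil_self] at ha hb ⊢
      simp [hab, bil_comm b a, ha, hb]
    have h1 := eq_smul_e0 hq hw
    have h2 : bil a (b - s • a) = 0 := by simp [hab, bil_self, ha]
    rw [h1, bil_comm, map_smul, LinearMap.smul_apply, bil_e0] at h2
    have h3 : (b - s • a) (i0 m) = 0 := by simpa [hl] using h2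
    rw [h3, zero_smul, sub_eq_zero] at h1
    exact hi s h1.symm

/-! ### Derivatives and Taylor expansion of smooth curves -/

section Taylor

variable {E : Type*} [NormedAddCommGroup E] [NormedSpace ℝ E] {c : ℝ → E}

theorem SmoothNear.hasDerivAt (h : SmoothNear c) :
    ∀ᶠ t in 𝓝 (0 : ℝ), HasDerivAt c (deriv c t) t :=
  h.mono fun _ ht => (ht.differentiableAt (by simp)).hasDerivAt

theorem SmoothNear.deriv (h : SmoothNear c) : SmoothNear (deriv c) :=
  h.mono fun _ ht => (ht.fderiv_right (m := ∞) (by simp)).clm_apply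
    (contDiffAt_const (c := (1 : ℝ)))

/-- The derivative of the remainder is the first-order remainder of `c'`, which is `o(t)` because
`c'` is differentiable at `0`; integrating along the ball raises the order by one. -/
theorem SmoothNear.taylor_isLittleO (h : SmoothNear c) :
    (fun t => c t - (c 0 + t • _root_.deriv c 0 + (t ^ 2 / 2) • _root_.deriv (_root_.deriv c) 0))
      =o[𝓝 0] fun t : ℝ => t ^ 2 := by
  set b := _root_.deriv c 0
  set a := _root_.deriv (_root_.deriv c) 0
  obtain ⟨ε, hε, hball⟩ := Metric.eventually_nhds_iff_ball.1 h.hasDerivAt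
  have h2 : HasDerivAt (_root_.deriv c) a 0 := h.deriv.hasDerivAt.self_of_nhds
  have h3 := hasDerivAt_iff_isLittleO.1 h2
  have hd : ∀ t ∈ Metric.ball (0 : ℝ) ε,
      HasDerivWithinAt (fun t => c t - (t • b + (t ^ 2 / 2) • a))
        (_root_.deriv c t - b - t • a) (Metric.ball 0 ε) t := by
    intro t ht
    have e1 : HasDerivAt (fun t : ℝ => t • b) b t := by
      simpa using (hasDerivAt_id t).smul_const b
    have e2 : HasDerivAt (fun t : ℝ => (t ^ 2 / 2) • a) (t • a) t := by
      have := (((hasDerivAt_id t).pow 2).div_const 2).smul_const a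
      convert! this using 1
      simp
    have := ((hball t ht).sub (e1.add e2)).hasDerivWithinAt (s := Metric.ball 0 ε)
    rw [sub_sub (_root_.deriv c t)]
    exact this
  have hn : 𝓝[Metric.ball (0 : ℝ) ε] 0 = 𝓝 0 :=
    Metric.isOpen_ball.nhdsWithin_eq (Metric.mem_ball_self hε)
  have h4 := (convex_ball (0 : ℝ) ε).isLittleO_pow_succ_real (n := 1) (Metric.mem_ball_self hε) hd
    (by simpa [hn] using h3)
  rw [hn] at h4
  refine h4.congr (fun t => ?_) fun t => by simp
  simp only [zero_smul, zero_add, ne_eq, OfNat.ofNat_ne_zero, not_false_eq_true, zero_pow, zero_div,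
    sub_zero]
  abel

end Taylor

/-! ### The velocities of lifts -/

theorem IsLift.eventually_qL {m : ℕ} {c : ℝ → Lor m} {γ : ℝ → Moebius m} (h : IsLift c γ) :
    ∀ᶠ t in 𝓝 (0 : ℝ), qL (c t) = 0 := by
  filter_upwards [h.2] with t ⟨h1, h2⟩
  rw [← qL_rep_mk (c t) h1, h2]
  exact (γ t).2

theorem hasDerivAt_bil {m : ℕ} {u v : ℝ → Lor m} {u' v' : Lor m} {t : ℝ} (hu : HasDerivAt u u' t)
    (hv : HasDerivAt v v' t) :
    HasDerivAt (fun s => bil (u s) (v s)) (bil u' (v t) + bil (u t) v') t := by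
  rw [hasDerivAt_pi] at hu hv
  have hs : HasDerivAt (fun s => ∑ k : Fin m, u s (iMid k) * v s (iMid k))
      (∑ k : Fin m, (u' (iMid k) * v t (iMid k) + u t (iMid k) * v' (iMid k))) t :=
    HasDerivAt.fun_sum fun k _ => (hu _).mul (hv _)
  have := ((((hu (i0 m)).mul (hv (iLast m))).add ((hu (iLast m)).mul (hv (i0 m)))).neg).add
    (((hu (i1 m)).mul (hv (i1 m))).add hs)
  refine this.congr_deriv ?_
  simp only [bil_apply, Finset.sum_add_distrib]
  ring

/-- The equations of the submanifold of velocities of lifts of regular curves. -/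
structure IsVelocity {m : ℕ} (v : Lor m × Lor m × Lor m) : Prop where
  ne_zero : v.1 ≠ 0
  null : qL v.1 = 0
  orthogonal : bil v.1 v.2.1 = 0
  pos : 0 < qL v.2.1
  acceleration : bil v.1 v.2.2 = -qL v.2.1

/-- Regularity is only given for some lift `d`. Any other lift is `f • d`, with derivative `f • d' +
f' • d`, so the change of pair is triangular with diagonal entries `f 0 ≠ 0`. -/
theorem LiftedCurve.linearIndependent {m : ℕ} (x : LiftedCurve m) :
    LinearIndependent ℝ ![x.1.2 0, deriv x.1.2 0] := by
  obtain ⟨⟨γ, c⟩, hc⟩ := x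
  obtain ⟨d, hd, hl⟩ := γ.regular
  obtain ⟨f, hf, hne, heq⟩ := hc.exists_factor hd
  change LinearIndependent ℝ ![c 0, deriv c 0]
  have h0 : c 0 = f 0 • d 0 := heq.self_of_nhds
  have hf0 : f 0 ≠ 0 := hne.self_of_nhds
  have h1 : deriv c 0 = f 0 • deriv d 0 + deriv f 0 • d 0 := by
    rw [EventuallyEq.deriv_eq heq]
    exact (hf.hasDerivAt.self_of_nhds.smul hd.1.hasDerivAt.self_of_nhds).deriv
  rw [LinearIndependent.pair_iff] at hl ⊢
  intro s t hst
  rw [h0, h1] at hst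
  obtain ⟨e1, e2⟩ := hl (s * f 0 + t * deriv f 0) (t * f 0) (by rw [← hst]; module)
  have ht : t = 0 := by simpa [hf0] using e2
  subst ht
  refine ⟨by simpa [hf0] using e1, rfl⟩

/-- The equations are `qL c = 0` and its first two derivatives. Positivity holds because a vector
orthogonal to a light-like one and independent of it is space-like. -/
theorem isVelocity_velocity {m : ℕ} (x : LiftedCurve m) : IsVelocity (velocity x) := by
  have hq := x.2.eventually_qL
  have hd := x.2.1.hasDerivAt
  have hdd := x.2.1.deriv.hasDerivAt.self_of_nhds
  have h1 : ∀ᶠ t in 𝓝 (0 : ℝ), bil (x.1.2 t) (deriv x.1.2 t) = 0 := by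
    filter_upwards [hq.eventually_nhds, hd] with t ht h
    have e1 := hasDerivAt_bil h h
    have e2 : HasDerivAt (fun s => bil (x.1.2 s) (x.1.2 s)) 0 t :=
      (hasDerivAt_const t (0 : ℝ)).congr_of_eventuallyEq (ht.mono fun s hs => (bil_self _).trans hs)
    have := e1.unique e2
    rw [bil_comm] at this
    linarith
  have h2 : bil (deriv x.1.2 0) (deriv x.1.2 0) + bil (x.1.2 0) (deriv (deriv x.1.2) 0) = 0 :=
    (hasDerivAt_bil hd.self_of_nhds hdd).unique
      ((hasDerivAt_const 0 (0 : ℝ)).congr_of_eventuallyEq h1)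
  refine ⟨x.2.2.self_of_nhds.choose, hq.self_of_nhds, h1.self_of_nhds,
    qL_pos_of_orthogonal hq.self_of_nhds h1.self_of_nhds x.linearIndependent, ?_⟩
  rw [bil_self] at h2
  simp only [velocity]
  linarith

/-- Two lifted curves whose velocities span the same flag have the same unparameterized second
jet. -/
theorem liftedJet_eq_of_velocity {m : ℕ} {x y : LiftedCurve m} {l μ ν α β δ : ℝ}
    (h0 : (velocity y).1 = l • (velocity x).1)
    (h1 : (velocity y).2.1 = μ • (velocity x).2.1 + ν • (velocity x).1)
    (h2 : (velocity y).2.2 = α • (velocity x).2.2 + β • (velocity x).2.1 + δ • (velocity x).1) :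
    liftedJet y = liftedJet x := by
  have hx := isVelocity_velocity x
  have hy := isVelocity_velocity y
  have hxt := x.2.1.taylor_isLittleO
  have hyt := y.2.1.taylor_isLittleO
  change (fun t => x.1.2 t - ((velocity x).1 + t • (velocity x).2.1 +
    (t ^ 2 / 2) • (velocity x).2.2)) =o[𝓝 0] _ at hxt
  change (fun t => y.1.2 t - ((velocity y).1 + t • (velocity y).2.1 +
    (t ^ 2 / 2) • (velocity y).2.2)) =o[𝓝 0] _ at hyt
  have hl : l ≠ 0 := by
    rintro rfl
    exact hy.ne_zero (by rw [h0, zero_smul])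
  have hq : qL (velocity y).2.1 = μ ^ 2 * qL (velocity x).2.1 := by
    have e := hx.orthogonal
    have n := hx.null
    rw [h1, ← bil_self, ← bil_self]
    rw [← bil_self] at n
    simp only [map_add, map_smul, LinearMap.add_apply, LinearMap.smul_apply, smul_eq_mul,
      bil_comm _ (velocity x).1, e, n]
    ring
  have hμ : μ ≠ 0 := by
    rintro rfl
    have := hy.pos
    rw [hq] at this
    simp at this
  -- The coefficient of the second derivative is not free: comparing the acceleration equations of
  -- both velocities determines it.
  have hlα : l * α = μ ^ 2 := by
    have e := hy.acceleration
    rw [hq, h0, h2] at e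
    have n := hx.null
    rw [← bil_self] at n
    simp only [map_add, map_smul, LinearMap.smul_apply, smul_eq_mul, hx.orthogonal, n,
      hx.acceleration] at e
    have := hx.pos.ne'
    refine mul_right_cancel₀ this ?_
    linear_combination -e
  -- The factor `G = 1/l + G1 t + G2 t²` and the parameter change `φ = p t + r t²` are found by
  -- comparing coefficients in `G(t) y(t) = x(φ(t)) + o(t²)`. The `x₀`-components give `G1` and
  -- `G2`, the `x₁`-components give `p` and `r`, and the `x₂`-component requires exactly `l α = μ²`.
  -- Here `x₀, x₁, x₂` are the entries of the velocity of `x`.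
  set G1 : ℝ := -(ν / l ^ 2)
  set G2 : ℝ := -((δ / (2 * l) + G1 * ν) / l)
  set r : ℝ := β / (2 * l) + G1 * μ
  set p : ℝ := μ / l
  let G : ℝ → ℝ := fun t => 1 / l + G1 * t + G2 * t ^ 2
  let φ : ℝ → ℝ := fun t => p * t + r * t ^ 2
  have hGc : ContDiff ℝ ∞ G := by fun_prop
  have hφc : ContDiff ℝ ∞ φ := by fun_prop
  have hφ : IsReparam φ := by
    refine ⟨Eventually.of_forall fun t => hφc.contDiffAt, by simp [φ], ?_⟩
    have hd : HasDerivAt φ (p * 1 + r * ((2 : ℕ) * (0 : ℝ) ^ (2 - 1) * 1)) 0 :=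
      ((hasDerivAt_id (0 : ℝ)).const_mul p).add (((hasDerivAt_id (0 : ℝ)).pow 2).const_mul r)
    rw [hd.deriv]
    simp [p, hl, hμ]
  have hG0 : ∀ᶠ t in 𝓝 (0 : ℝ), G t ≠ 0 :=
    hGc.continuous.continuousAt.eventually_ne (by simp [G, hl])
  refine Quotient.sound (?_ : Contact _ _)
  refine ⟨fun t => G t • y.1.2 t, x.1.2, φ, ⟨?_, ?_⟩, x.2, hφ, ?_⟩
  · filter_upwards [y.2.1] with t ht
    exact hGc.contDiffAt.smul ht
  · filter_upwards [y.2.2, hG0] with t ⟨u1, u2⟩ u3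
    refine ⟨smul_ne_zero u3 u1, ?_⟩
    rw [← u2, Projectivization.mk_eq_mk_iff']
    exact ⟨_, rfl⟩
  · have o1 := (hGc.continuous.continuousAt.tendsto.isBigO_one ℝ (l := 𝓝 0)).smul_isLittleO hyt
    have o1 := o1.congr_right (g₂ := fun t : ℝ => t ^ 2) fun t => one_smul ℝ _
    have o2 := (hxt.comp_tendsto hφ.tendsto).trans_isBigO hφ.isBigO
    -- `t ^ 3 • K t` collects the terms of order three and four left over when the quadratic Taylor
    -- polynomials are multiplied by `G` and composed with `φ`.
    let K : ℝ → Lor m := fun t => (G1 / 2 + t * G2 / 2) • (velocity y).2.2 + G2 • (velocity y).2.1 -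
      (p * r + t * r ^ 2 / 2) • (velocity x).2.2
    have hK : Continuous K := by fun_prop
    have o3 : (fun t : ℝ => t ^ 3 • K t) =o[𝓝 0] fun t : ℝ => t ^ 2 := by
      have e := (Asymptotics.isLittleO_pow_pow (𝕜 := ℝ) (show 2 < 3 by norm_num)).smul_isBigO
        (hK.continuousAt.tendsto.isBigO_one ℝ (l := 𝓝 0))
      simpa using e
    refine ((o1.sub o2).add o3).congr_left fun t => ?_
    have c1 : (1 / l) * μ = p := by simp only [p]; ring
    have c2 : (1 / l) * ν + G1 * l = 0 := by simp only [G1]; field_simp; ring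
    have c3 : (1 / l) * α = p ^ 2 := by
      simp only [p]; field_simp; linear_combination hlα
    have c4 : (1 / l) * β / 2 + G1 * μ = r := by simp only [r]; ring
    have c5 : (1 / l) * δ / 2 + G1 * ν + G2 * l = 0 := by simp only [G2]; field_simp; ring
    have c6 : (1 / l) * l = 1 := by field_simp
    funext i
    have k0 := congrFun h0 i
    have k1 := congrFun h1 i
    have k2 := congrFun h2 i
    simp only [Pi.add_apply, Pi.sub_apply, Pi.smul_apply, smul_eq_mul, Function.comp_apply, K, G,
      φ] at *
    generalize G2 = G2 at *
    generalize G1 = G1 at *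
    generalize r = r at *
    generalize p = p at *
    generalize 1 / l = L at *
    generalize (velocity y).1 i = A' at *
    generalize (velocity y).2.1 i = B' at *
    generalize (velocity y).2.2 i = C' at *
    generalize (velocity x).1 i = A at *
    generalize (velocity x).2.1 i = B at *
    generalize (velocity x).2.2 i = C at *
    subst k0 k1 k2
    linear_combination (-A) * c6 - t * B * c1 - t * A * c2 - t ^ 2 / 2 * C * c3 -
      t ^ 2 * B * c4 - t ^ 2 * A * c5

/-! ### The action on lifted curves -/

/-- The image of a lifted curve under an element of `SO(m+2,1)`. -/
noncomputable def LiftedCurve.map {m : ℕ} (g : SO m) (x : LiftedCurve m) : LiftedCurve m :=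
  ⟨(g • x.1.1, fun t => (mat g).mulVec (x.1.2 t)), x.2.smul g⟩

theorem liftedJet_map {m : ℕ} (g : SO m) (x : LiftedCurve m) :
    liftedJet (x.map g) = g • liftedJet x := rfl

theorem hasDerivAt_mulVec {m : ℕ} (A : Matrix (Idx m) (Idx m) ℝ) {c : ℝ → Lor m} {c' : Lor m}
    {t : ℝ} (h : HasDerivAt c c' t) : HasDerivAt (fun s => A.mulVec (c s)) (A.mulVec c') t :=
  (LinearMap.toContinuousLinearMap A.mulVecLin).hasFDerivAt.comp_hasDerivAt t h

theorem velocity_map {m : ℕ} (g : SO m) (x : LiftedCurve m) :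
    velocity (x.map g) = ((mat g).mulVec (velocity x).1, (mat g).mulVec (velocity x).2.1,
      (mat g).mulVec (velocity x).2.2) := by
  have h1 : ∀ᶠ t in 𝓝 (0 : ℝ), deriv (x.map g).1.2 t = (mat g).mulVec (deriv x.1.2 t) :=
    x.2.1.hasDerivAt.mono fun t ht => (hasDerivAt_mulVec (mat g) ht).deriv
  have h2 : deriv (deriv (x.map g).1.2) 0 = (mat g).mulVec (deriv (deriv x.1.2) 0) := by
    rw [EventuallyEq.deriv_eq h1]
    exact (hasDerivAt_mulVec (mat g) x.2.1.deriv.hasDerivAt.self_of_nhds).deriv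
  simp only [velocity, h1.self_of_nhds, h2]
  rfl

/-- The base curve with its standard lift. -/
noncomputable def baseLifted (m : ℕ) : LiftedCurve m :=
  ⟨(baseCurve m, baseLift m), Eventually.of_forall fun _ => (contDiff_baseLift m).contDiffAt,
    Eventually.of_forall fun t => ⟨baseLift_ne_zero m t, rfl⟩⟩

theorem liftedJet_baseLifted (m : ℕ) : liftedJet (baseLifted m) = baseJet m := rfl

theorem velocity_baseLifted (m : ℕ) : velocity (baseLifted m) = (e0 m, e1 m, eLast m) := by
  have h1 : ∀ t, HasDerivAt (baseLift m) (e1 m + t • eLast m) t := by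
    intro t
    rw [hasDerivAt_pi]
    rintro (⟨⟩ | ⟨⟩ | k | ⟨⟩)
    · simpa [e1, eLast, baseLift] using hasDerivAt_const t (1 : ℝ)
    · simpa [e1, eLast, baseLift] using hasDerivAt_id' t
    · simpa [e1, eLast, baseLift] using hasDerivAt_const t (0 : ℝ)
    · have := ((hasDerivAt_id t).pow 2).div_const 2
      simpa [e1, eLast, baseLift] using this
  have h2 : deriv (baseLift m) = fun t => e1 m + t • eLast m := funext fun t => (h1 t).deriv
  have h3 : HasDerivAt (fun t : ℝ => e1 m + t • eLast m) (eLast m) 0 := by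
    simpa using ((hasDerivAt_id (0 : ℝ)).smul_const (eLast m)).const_add (e1 m)
  have h0 : baseLift m 0 = e0 m := by
    funext i
    rcases i with ⟨⟩ | ⟨⟩ | k | ⟨⟩ <;> simp [baseLift, e0]
  simp only [velocity, baseLifted, h2, h3.deriv, h0]
  simp

/-! ### Frames adapted to a velocity -/

/-- Triples of vectors with the same inner products as `e₀, e₁, e_{m+2}`. -/
structure IsFrame {m : ℕ} (u v w : Lor m) : Prop where
  left : qL u = 0
  mid : qL v = 1
  right : qL w = 0
  left_mid : bil u v = 0
  left_right : bil u w = -1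
  mid_right : bil v w = 0

theorem IsFrame.map {m : ℕ} {u v w : Lor m} (h : IsFrame u v w) {A : Matrix (Idx m) (Idx m) ℝ}
    (hA : IsIsom A) : IsFrame (A.mulVec u) (A.mulVec v) (A.mulVec w) where
  left := (hA u).trans h.left
  mid := (hA v).trans h.mid
  right := (hA w).trans h.right
  left_mid := (hA.bil_eq u v).trans h.left_mid
  left_right := (hA.bil_eq u w).trans h.left_right
  mid_right := (hA.bil_eq v w).trans h.mid_right

/-- The unit vector in the direction of the velocity. -/
noncomputable def frameMid {m : ℕ} (v : Lor m × Lor m × Lor m) : Lor m :=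
  (√(qL v.2.1))⁻¹ • v.2.1

/-- The light-like vector, in the span of a second-order velocity, that completes the frame. -/
noncomputable def frameRight {m : ℕ} (v : Lor m × Lor m × Lor m) : Lor m :=
  let w := (qL v.2.1)⁻¹ • v.2.2
  let s := bil w (frameMid v)
  w - s • frameMid v + ((qL w - s ^ 2) / 2) • v.1

/-- This is Gram–Schmidt: by the acceleration equation, dividing by `qL v.2.1` makes the third
vector pair to `-1` with `v.1`. Removing its component along the middle vector and adding a multiple
of `v.1` then makes it orthogonal and light-like without affecting that pairing. -/
theorem IsVelocity.isFrame {m : ℕ} {v : Lor m × Lor m × Lor m} (h : IsVelocity v) :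
    IsFrame v.1 (frameMid v) (frameRight v) := by
  have hq := h.pos
  have hs : √(qL v.2.1) ≠ 0 := (Real.sqrt_pos.2 hq).ne'
  have h1 : qL (frameMid v) = 1 := by
    rw [frameMid, qL_smul, inv_pow, Real.sq_sqrt hq.le, inv_mul_cancel₀ hq.ne']
  have h2 : bil v.1 (frameMid v) = 0 := by
    rw [frameMid, map_smul, h.orthogonal, smul_zero]
  have h3 : bil v.1 ((qL v.2.1)⁻¹ • v.2.2) = -1 := by
    rw [map_smul, h.acceleration, smul_eq_mul, mul_neg, inv_mul_cancel₀ hq.ne']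
  have h0 := h.null
  refine ⟨h.null, h1, ?_, h2, ?_, ?_⟩
  all_goals
    simp only [frameRight]
    generalize (qL v.2.1)⁻¹ • v.2.2 = w at *
    generalize frameMid v = u at *
    simp only [← bil_self] at *
    simp only [map_add, map_sub, map_smul, LinearMap.add_apply, LinearMap.sub_apply,
      LinearMap.smul_apply, smul_eq_mul, bil_comm u v.1, bil_comm w v.1, bil_comm u w, h0, h1, h2,
      h3]
    ring

theorem velocity_mid_eq {m : ℕ} {v : Lor m × Lor m × Lor m} (h : 0 < qL v.2.1) :
    v.2.1 = √(qL v.2.1) • frameMid v := by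
  rw [frameMid, smul_inv_smul₀ (Real.sqrt_pos.2 h).ne']

theorem exists_velocity_right_eq {m : ℕ} {v : Lor m × Lor m × Lor m} (h : 0 < qL v.2.1) :
    ∃ s t : ℝ, v.2.2 = qL v.2.1 • frameRight v + s • frameMid v + t • v.1 := by
  set w := (qL v.2.1)⁻¹ • v.2.2 with hw
  refine ⟨qL v.2.1 * bil w (frameMid v), -(qL v.2.1 * ((qL w - bil w (frameMid v) ^ 2) / 2)), ?_⟩
  have e : v.2.2 = qL v.2.1 • w := by rw [hw, smul_inv_smul₀ h.ne']
  refine e.trans ?_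
  simp only [frameRight, ← hw]
  module

/-- An isometry that matches the frames of two velocities up to scale matches the jets. -/
theorem smul_liftedJet_eq {m : ℕ} {x y : LiftedCurve m} {g : SO m} {a b c : ℝ}
    (h0 : (mat g).mulVec (velocity x).1 = a • (velocity y).1)
    (h1 : (mat g).mulVec (frameMid (velocity x)) = b • frameMid (velocity y))
    (h2 : (mat g).mulVec (frameRight (velocity x)) = c • frameRight (velocity y)) :
    g • liftedJet x = liftedJet y := by
  have hx := (isVelocity_velocity x).pos
  have hy := (isVelocity_velocity y).pos
  obtain ⟨s, t, hst⟩ := exists_velocity_right_eq hx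
  rw [← liftedJet_map]
  refine liftedJet_eq_of_velocity (l := a) (μ := √(qL (velocity x).2.1) * b *
    (√(qL (velocity y).2.1))⁻¹) (ν := 0)
    (α := qL (velocity x).2.1 * c * (qL (velocity y).2.1)⁻¹) (β := (s * b -
      qL (velocity x).2.1 * c * bil ((qL (velocity y).2.1)⁻¹ • (velocity y).2.2)
        (frameMid (velocity y))) * (√(qL (velocity y).2.1))⁻¹)
    (δ := t * a + qL (velocity x).2.1 * c * ((qL ((qL (velocity y).2.1)⁻¹ • (velocity y).2.2) -
      bil ((qL (velocity y).2.1)⁻¹ • (velocity y).2.2) (frameMid (velocity y)) ^ 2) / 2)) ?_ ?_ ?_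
  · rw [velocity_map]
    exact h0
  · rw [velocity_map]
    dsimp only
    rw [velocity_mid_eq hx, Matrix.mulVec_smul, h1, frameMid, zero_smul, add_zero, smul_smul,
      smul_smul, ← velocity_mid_eq hx]
  · rw [velocity_map]
    dsimp only
    rw [hst, Matrix.mulVec_add, Matrix.mulVec_add, Matrix.mulVec_smul, Matrix.mulVec_smul,
      Matrix.mulVec_smul, h0, h1, h2]
    simp only [frameRight]
    set w := bil ((qL (velocity y).2.1)⁻¹ • (velocity y).2.2) (frameMid (velocity y))
    simp only [frameMid]
    module

theorem frameMid_baseLifted (m : ℕ) : frameMid (velocity (baseLifted m)) = e1 m := by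
  simp [frameMid, velocity_baseLifted, qL_e1]

theorem frameRight_baseLifted (m : ℕ) : frameRight (velocity (baseLifted m)) = eLast m := by
  have h3 : bil (eLast m) (e1 m) = 0 := by rw [bil_eLast]; simp [e1]
  simp only [frameRight, frameMid_baseLifted]
  simp [velocity_baseLifted, qL_e1, qL_eLast, h3]

/-! ### Transitivity -/

/-- The square of `a - e₀` is `-2 * bil a e₀`, twice the last coordinate of `a`. So a reflection
works unless that coordinate is zero, and then `a` already lies on the line of `e₀`. -/
theorem exists_isIsom_mulVec_eq_smul_e0 {m : ℕ} {a : Lor m} (ha : qL a = 0) (ha0 : a ≠ 0) :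
    ∃ A : Matrix (Idx m) (Idx m) ℝ, ∃ k : ℝ, IsIsom A ∧ k ≠ 0 ∧ A.mulVec a = k • e0 m := by
  by_cases hl : a (iLast m) = 0
  · have h := eq_smul_e0 ha.le hl
    refine ⟨1, a (i0 m), IsIsom.one, fun h0 => ha0 (by rw [h, h0, zero_smul]), ?_⟩
    rw [Matrix.one_mulVec, ← h]
  · obtain ⟨A, hA, h, -⟩ := exists_isIsom_mulVec_eq (ha.trans (qL_e0 m).symm) (Or.inr (by
      have h1 := qL_e0 m
      have h2 : e0 m (iLast m) = 0 := by simp [e0]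
      rw [← bil_self] at ha h1 ⊢
      simpa [bil_comm a, ha, h1, bil_e0, h2, ← two_mul] using hl))
    exact ⟨A, 1, hA, one_ne_zero, by rw [h, one_smul]⟩

/-- Isometries act transitively on frames up to scale. -/
theorem IsFrame.exists_isIsom {m : ℕ} {u v w : Lor m} (h : IsFrame u v w) :
    ∃ A : Matrix (Idx m) (Idx m) ℝ, ∃ k : ℝ, IsIsom A ∧ A.mulVec u = k • e0 m ∧
      A.mulVec v = e1 m ∧ A.mulVec w = k⁻¹ • eLast m := by
  have hu0 : u ≠ 0 := by
    rintro rfl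
    simpa using h.left_right
  obtain ⟨A, k, hA, hk, hu⟩ := exists_isIsom_mulVec_eq_smul_e0 h.left hu0
  have h1 := h.map hA
  rw [hu] at h1
  have hw1 : (k • A.mulVec w) (iLast m) = 1 := by
    have := h1.left_right
    rw [map_smul, LinearMap.smul_apply, bil_e0] at this
    simp only [smul_eq_mul, Pi.smul_apply] at this ⊢
    linarith
  have hqw : qL (k • A.mulVec w) = 0 := by rw [qL_smul, h1.right, mul_zero]
  -- Both vectors are light-like with last coordinate `1`. If their difference were light-like it
  -- would be `s • e₀`, and the vanishing of `qL` on `e_{m+2} + s • e₀` gives `s = 0`. Equal last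
  -- coordinates also mean that the reflection fixes `e₀`.
  obtain ⟨B, hB, hBw, hBfix⟩ := exists_isIsom_mulVec_eq (hqw.trans (qL_eLast m).symm) (by
    by_contra hcon
    push Not at hcon
    have e := eq_smul_e0 hcon.2.le (by simpa [eLast] using sub_eq_zero.2 hw1)
    set s := (k • A.mulVec w - eLast m) (i0 m)
    rw [sub_eq_iff_eq_add] at e
    have hq := hqw
    rw [e, ← bil_self] at hq
    have l0 := qL_e0 m
    have l1 := qL_eLast m
    rw [← bil_self] at l0 l1
    have l2 : bil (e0 m) (eLast m) = -1 := by rw [bil_e0]; simp [eLast]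
    simp only [map_add, map_smul, LinearMap.add_apply, LinearMap.smul_apply, smul_eq_mul,
      bil_comm (eLast m) (e0 m), l0, l1, l2] at hq
    have hs : s = 0 := by linarith
    exact hcon.1 (by rw [e, hs, zero_smul, zero_add]))
  have hB0 : B.mulVec (e0 m) = e0 m := by
    refine hBfix _ ?_
    rw [bil_comm, bil_e0, hw1, bil_comm, bil_e0]
    simp [eLast]
  have h2 := h1.map hB
  rw [Matrix.mulVec_smul, hB0] at h2
  have hBw' : B.mulVec (A.mulVec w) = k⁻¹ • eLast m := by
    rw [← hBw, Matrix.mulVec_smul, inv_smul_smul₀ hk]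
  rw [hBw'] at h2
  have hv0 : bil (e0 m) (B.mulVec (A.mulVec v)) = 0 := by
    simpa [hk] using h2.left_mid
  have hvl : bil (eLast m) (B.mulVec (A.mulVec v)) = 0 := by
    have := h2.mid_right
    rw [bil_comm] at this
    simpa [hk] using this
  have he0 : bil (e0 m) (e1 m) = 0 := by rw [bil_e0]; simp [e1]
  have hel : bil (eLast m) (e1 m) = 0 := by rw [bil_eLast]; simp [e1]
  -- The difference is orthogonal to `e₀` and `e_{m+2}`, hence lies in a Euclidean subspace and
  -- cannot be light-like unless it is zero.
  obtain ⟨C, hC, hCv, hCfix⟩ := exists_isIsom_mulVec_eq (h2.mid.trans (qL_e1 m).symm) (by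
    by_contra hcon
    push Not at hcon
    have a0 : (B.mulVec (A.mulVec v) - e1 m) (iLast m) = 0 := by
      rw [← neg_eq_zero, ← bil_e0, map_sub, hv0, he0, sub_zero]
    have a1 : (B.mulVec (A.mulVec v) - e1 m) (i0 m) = 0 := by
      rw [← neg_eq_zero, ← bil_eLast, map_sub, hvl, hel, sub_zero]
    have e := eq_smul_e0 hcon.2.le a0
    rw [a1, zero_smul, sub_eq_zero] at e
    exact hcon.1 e)
  refine ⟨C * (B * A), k, hC.mul (hB.mul hA), ?_, ?_, ?_⟩
  · rw [← Matrix.mulVec_mulVec, ← Matrix.mulVec_mulVec, hu, Matrix.mulVec_smul, hB0,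
      Matrix.mulVec_smul, hCfix _ (by rw [bil_comm, hv0, bil_comm, he0])]
  · rw [← Matrix.mulVec_mulVec, ← Matrix.mulVec_mulVec, hCv]
  · rw [← Matrix.mulVec_mulVec, ← Matrix.mulVec_mulVec, hBw', Matrix.mulVec_smul,
      hCfix _ (by rw [bil_comm, hvl, bil_comm, hel])]

/-- The diagonal isometry of determinant `-1` that changes the sign of `e₁`. -/
def flip (m : ℕ) : Matrix (Idx m) (Idx m) ℝ :=
  Matrix.diagonal (Sum.elim 1 (Sum.elim (-1) 1))

theorem isIsom_flip (m : ℕ) : IsIsom (flip m) := fun x => by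
  simp [qL, flip, Matrix.mulVec_diagonal]

theorem det_flip (m : ℕ) : (flip m).det = -1 := by
  simp [flip, Matrix.det_diagonal, Fintype.prod_sum_type]

theorem exists_smul_baseJet_eq {m : ℕ} (x : LiftedCurve m) :
    ∃ g : SO m, g • baseJet m = liftedJet x := by
  suffices ∃ g : SO m, g • liftedJet x = baseJet m by
    obtain ⟨g, hg⟩ := this
    exact ⟨g⁻¹, by rw [← hg, inv_smul_smul]⟩
  obtain ⟨A, k, hA, h0, h1, h2⟩ := (isVelocity_velocity x).isFrame.exists_isIsom
  rw [← liftedJet_baseLifted]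
  rcases mul_self_eq_one_iff.1 ((sq _).symm.trans hA.det_sq) with hd | hd
  · refine ⟨hA.toSO hd, smul_liftedJet_eq (a := k) (b := 1) (c := k⁻¹) ?_ ?_ ?_⟩
    · rw [velocity_baseLifted]
      exact h0
    · rw [frameMid_baseLifted, one_smul]
      exact h1
    · rw [frameRight_baseLifted]
      exact h2
  -- The determinant is corrected by reversing `e₁`. Jets are unparameterized, so the sign of the
  -- middle vector does not matter; this works even for `m = 0`, where no other space-like direction
  -- is left.
  · have hd' : (flip m * A).det = 1 := by rw [Matrix.det_mul, det_flip, hd]; norm_num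
    refine ⟨((isIsom_flip m).mul hA).toSO hd',
      smul_liftedJet_eq (a := k) (b := -1) (c := k⁻¹) ?_ ?_ ?_⟩
    · rw [velocity_baseLifted, IsIsom.mat_toSO, ← Matrix.mulVec_mulVec, h0, Matrix.mulVec_smul]
      congr 1
      simp [flip, e0]
    · rw [frameMid_baseLifted, IsIsom.mat_toSO, ← Matrix.mulVec_mulVec, h1, neg_smul, one_smul]
      simp [flip, e1, Pi.single_neg]
    · rw [frameRight_baseLifted, IsIsom.mat_toSO, ← Matrix.mulVec_mulVec, h2, Matrix.mulVec_smul]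
      congr 1
      simp [flip, eLast]

/-! ### A smooth local section of the orbit map -/

section Smooth

variable {V : Type*} [NormedAddCommGroup V] [NormedSpace ℝ V] {m : ℕ} {n : WithTop ℕ∞} {v : V}

theorem contDiffAt_bil {f g : V → Lor m} (hf : ContDiffAt ℝ n f v) (hg : ContDiffAt ℝ n g v) :
    ContDiffAt ℝ n (fun x => bil (f x) (g x)) v := by
  rw [contDiffAt_pi] at hf hg
  have hs : ContDiffAt ℝ n (fun x => ∑ k : Fin m, f x (iMid k) * g x (iMid k)) v :=
    ContDiffAt.sum fun k _ => (hf _).mul (hg _)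
  exact ((((hf (i0 m)).mul (hg (iLast m))).add ((hf (iLast m)).mul (hg (i0 m)))).neg).add
    (((hf (i1 m)).mul (hg (i1 m))).add hs)

theorem contDiffAt_qL {f : V → Lor m} (hf : ContDiffAt ℝ n f v) :
    ContDiffAt ℝ n (fun x => qL (f x)) v := by
  simp only [← bil_self]
  exact contDiffAt_bil hf hf

theorem contDiffAt_rotation {f g : V → Lor m} (hf : ContDiffAt ℝ n f v) (hg : ContDiffAt ℝ n g v)
    (h : qL (f v) ≠ 0) (h' : qL (f v) + bil (f v) (g v) ≠ 0) (i j : Idx m) :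
    ContDiffAt ℝ n (fun x => rotation (f x) (g x) i j) v := by
  have e : ∀ x, rotation (f x) (g x) i j = (rotation (f x) (g x)).mulVec (Pi.single j 1) i := by
    intro x
    rw [Matrix.mulVec_single_one, Matrix.col_apply]
  have hc : ContDiffAt ℝ n (fun _ : V => (Pi.single j 1 : Lor m)) v := contDiffAt_const
  simp only [e, rotation_mulVec]
  have a1 := (((contDiffAt_qL hf).add (contDiffAt_bil hf hg)).inv h').mul
    (contDiffAt_bil (hf.add hg) hc)
  have a2 := ((contDiffAt_const (c := (2 : ℝ))).div (contDiffAt_qL hf) h).mul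
    (contDiffAt_bil hf hc)
  exact contDiffAt_pi.1 ((hc.sub (a1.smul (hf.add hg))).add (a2.smul hg)) i

theorem contDiffAt_matrix_mul {A B : V → Matrix (Idx m) (Idx m) ℝ}
    (hA : ∀ i j, ContDiffAt ℝ n (fun x => A x i j) v)
    (hB : ∀ i j, ContDiffAt ℝ n (fun x => B x i j) v) (i j : Idx m) :
    ContDiffAt ℝ n (fun x => (A x * B x) i j) v := by
  simp only [Matrix.mul_apply]
  exact ContDiffAt.sum fun k _ => (hA _ _).mul (hB _ _)

theorem contDiffAt_mulVec {A : V → Matrix (Idx m) (Idx m) ℝ} {f : V → Lor m}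
    (hA : ∀ i j, ContDiffAt ℝ n (fun x => A x i j) v) (hf : ContDiffAt ℝ n f v) :
    ContDiffAt ℝ n (fun x => (A x).mulVec (f x)) v := by
  refine contDiffAt_pi.2 fun i => ?_
  simp only [Matrix.mulVec, dotProduct]
  exact ContDiffAt.sum fun k _ => (hA _ _).mul (contDiffAt_pi.1 hf _)

end Smooth

theorem contDiffAt_frameMid {m : ℕ} {n : WithTop ℕ∞} {v : Lor m × Lor m × Lor m}
    (h : 0 < qL v.2.1) : ContDiffAt ℝ n frameMid v := by
  have h2 : ContDiffAt ℝ n (fun v : Lor m × Lor m × Lor m => v.2.1) v :=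
    contDiffAt_snd.fst
  exact (((contDiffAt_qL h2).sqrt h.ne').inv (Real.sqrt_pos.2 h).ne').smul h2

theorem contDiffAt_frameRight {m : ℕ} {n : WithTop ℕ∞} {v : Lor m × Lor m × Lor m}
    (h : 0 < qL v.2.1) : ContDiffAt ℝ n frameRight v := by
  have h1 := contDiffAt_frameMid (n := n) h
  have h2 : ContDiffAt ℝ n (fun v : Lor m × Lor m × Lor m => v.2.1) v := contDiffAt_snd.fst
  have h3 : ContDiffAt ℝ n (fun v : Lor m × Lor m × Lor m => v.2.2) v := contDiffAt_snd.snd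
  have h4 := ((contDiffAt_qL h2).inv h.ne').smul h3
  exact (h4.sub ((contDiffAt_bil h4 h1).smul h1)).add
    ((((contDiffAt_qL h4).sub ((contDiffAt_bil h4 h1).pow 2)).div_const 2).smul contDiffAt_fst)

/-! ### Smooth transport between nearby frames by three rotations. -/

section Transport

variable {m : ℕ}

/-- The first factor of `transport`, which matches the time-like vectors of two frames. -/
noncomputable def transportTime (v w : Lor m × Lor m × Lor m) : Matrix (Idx m) (Idx m) ℝ :=
  rotation (v.1 + frameRight v) (w.1 + frameRight w)

/-- The product of the first two factors of `transport`, which match the planes of light-like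
vectors of two frames. -/
noncomputable def transportPlane (v w : Lor m × Lor m × Lor m) : Matrix (Idx m) (Idx m) ℝ :=
  rotation ((transportTime v w).mulVec (v.1 - frameRight v)) (w.1 - frameRight w) *
    transportTime v w

/-- The isometry that maps the frame of `v` to the frame of `w`, depending smoothly on `w`. -/
noncomputable def transport (v w : Lor m × Lor m × Lor m) : Matrix (Idx m) (Idx m) ℝ :=
  rotation ((transportPlane v w).mulVec (frameMid v)) (frameMid w) * transportPlane v w

/-- The vectors of the frames of `v` and `w` are close enough for `transport v w`. -/
structure IsClose (v w : Lor m × Lor m × Lor m) : Prop where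
  time : qL (v.1 + frameRight v) + bil (v.1 + frameRight v) (w.1 + frameRight w) ≠ 0
  plane : qL ((transportTime v w).mulVec (v.1 - frameRight v)) +
    bil ((transportTime v w).mulVec (v.1 - frameRight v)) (w.1 - frameRight w) ≠ 0
  mid : qL ((transportPlane v w).mulVec (frameMid v)) +
    bil ((transportPlane v w).mulVec (frameMid v)) (frameMid w) ≠ 0

theorem IsFrame.qL_add {u v w : Lor m} (h : IsFrame u v w) : qL (u + w) = -2 := by
  have h1 := h.left
  have h2 := h.right
  rw [← bil_self] at *
  simp only [map_add, LinearMap.add_apply, bil_comm w u, h1, h2, h.left_right]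
  norm_num

theorem IsFrame.qL_sub {u v w : Lor m} (h : IsFrame u v w) : qL (u - w) = 2 := by
  have h1 := h.left
  have h2 := h.right
  rw [← bil_self] at *
  simp only [map_sub, LinearMap.sub_apply, bil_comm w u, h1, h2, h.left_right]
  norm_num

theorem IsFrame.bil_sub_add {u v w : Lor m} (h : IsFrame u v w) : bil (u - w) (u + w) = 0 := by
  have h1 := h.left
  have h2 := h.right
  rw [← bil_self] at *
  simp only [map_add, map_sub, LinearMap.sub_apply, bil_comm w u, h1, h2]
  norm_num

theorem IsFrame.bil_mid_add {u v w : Lor m} (h : IsFrame u v w) : bil v (u + w) = 0 := by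
  rw [map_add, bil_comm v u, h.left_mid, h.mid_right, add_zero]

theorem IsFrame.bil_mid_sub {u v w : Lor m} (h : IsFrame u v w) : bil v (u - w) = 0 := by
  rw [map_sub, bil_comm v u, h.left_mid, h.mid_right, sub_zero]

/-- A frame `u, v, w` is equivalent to the orthogonal vectors `u + w`, `u - w`, `v` of squares `-2`,
`2`, `1`. They are matched one at a time, and each later rotation moves only a plane orthogonal to
those already in place. -/
theorem isIsom_transport {v w : Lor m × Lor m × Lor m} (hv : IsVelocity v) (hw : IsVelocity w)
    (h : IsClose v w) :
    IsIsom (transport v w) ∧ (transport v w).mulVec v.1 = w.1 ∧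
      (transport v w).mulVec (frameMid v) = frameMid w ∧
      (transport v w).mulVec (frameRight v) = frameRight w := by
  have fv := hv.isFrame
  have fw := hw.isFrame
  have t0 : qL (v.1 + frameRight v) ≠ 0 := by rw [fv.qL_add]; norm_num
  have hT : IsIsom (transportTime v w) :=
    isIsom_rotation (fv.qL_add.trans fw.qL_add.symm) t0 h.time
  have tT : (transportTime v w).mulVec (v.1 + frameRight v) = w.1 + frameRight w :=
    rotation_mulVec_left t0 h.time
  have q1 : qL ((transportTime v w).mulVec (v.1 - frameRight v)) = 2 := (hT _).trans fv.qL_sub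
  have p0 : qL ((transportTime v w).mulVec (v.1 - frameRight v)) ≠ 0 := by rw [q1]; norm_num
  have hP : IsIsom (transportPlane v w) :=
    (isIsom_rotation (q1.trans fw.qL_sub.symm) p0 h.plane).mul hT
  have tP : (transportPlane v w).mulVec (v.1 + frameRight v) = w.1 + frameRight w := by
    rw [transportPlane, ← Matrix.mulVec_mulVec, tT]
    refine rotation_mulVec_of_orthogonal ?_ fw.bil_sub_add
    rw [← tT, hT.bil_eq, fv.bil_sub_add]
  have nP : (transportPlane v w).mulVec (v.1 - frameRight v) = w.1 - frameRight w := by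
    rw [transportPlane, ← Matrix.mulVec_mulVec]
    exact rotation_mulVec_left p0 h.plane
  have q2 : qL ((transportPlane v w).mulVec (frameMid v)) = 1 := (hP _).trans fv.mid
  have m0 : qL ((transportPlane v w).mulVec (frameMid v)) ≠ 0 := by rw [q2]; norm_num
  have hA : IsIsom (transport v w) :=
    (isIsom_rotation (q2.trans fw.mid.symm) m0 h.mid).mul hP
  have tA : (transport v w).mulVec (v.1 + frameRight v) = w.1 + frameRight w := by
    rw [transport, ← Matrix.mulVec_mulVec, tP]
    refine rotation_mulVec_of_orthogonal ?_ fw.bil_mid_add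
    rw [← tP, hP.bil_eq, fv.bil_mid_add]
  have nA : (transport v w).mulVec (v.1 - frameRight v) = w.1 - frameRight w := by
    rw [transport, ← Matrix.mulVec_mulVec, nP]
    refine rotation_mulVec_of_orthogonal ?_ fw.bil_mid_sub
    rw [← nP, hP.bil_eq, fv.bil_mid_sub]
  have e1 : ∀ x y : Lor m, x = (1 / 2 : ℝ) • ((x + y) + (x - y)) := fun x y => by module
  have e2 : ∀ x y : Lor m, y = (1 / 2 : ℝ) • ((x + y) - (x - y)) := fun x y => by module
  refine ⟨hA, ?_, ?_, ?_⟩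
  · rw [e1 v.1 (frameRight v), Matrix.mulVec_smul, Matrix.mulVec_add, tA, nA, ← e1]
  · rw [transport, ← Matrix.mulVec_mulVec]
    exact rotation_mulVec_left m0 h.mid
  · conv_lhs => rw [e2 v.1 (frameRight v)]
    rw [Matrix.mulVec_smul, Matrix.mulVec_sub, tA, nA, ← e2]

variable {v : Lor m × Lor m × Lor m}

theorem transport_self_aux (hv : IsVelocity v) :
    transportTime v v = 1 ∧ transportPlane v v = 1 ∧ transport v v = 1 := by
  have fv := hv.isFrame
  have h1 : transportTime v v = 1 := rotation_self (by rw [fv.qL_add]; norm_num)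
  have h2 : transportPlane v v = 1 := by
    rw [transportPlane, h1, Matrix.one_mulVec, rotation_self (by rw [fv.qL_sub]; norm_num), mul_one]
  refine ⟨h1, h2, ?_⟩
  rw [transport, h2, Matrix.one_mulVec, rotation_self (by rw [fv.mid]; norm_num), mul_one]

theorem IsClose.refl (hv : IsVelocity v) : IsClose v v := by
  have fv := hv.isFrame
  obtain ⟨h1, h2, -⟩ := transport_self_aux hv
  refine ⟨?_, ?_, ?_⟩
  · rw [bil_self, fv.qL_add]; norm_num
  · rw [h1, Matrix.one_mulVec, bil_self, fv.qL_sub]; norm_num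
  · rw [h2, Matrix.one_mulVec, bil_self, fv.mid]; norm_num

/-- At `w = v` all rotations are the identity and their denominators are nonzero; by continuity they
stay nonzero nearby. -/
theorem contDiffAt_transport (hv : IsVelocity v) :
    (∀ n : WithTop ℕ∞, ∀ i j, ContDiffAt ℝ n (fun w => transport v w i j) v) ∧
      ∀ᶠ w in 𝓝 v, IsClose v w := by
  have hc := IsClose.refl hv
  have fv := hv.isFrame
  have hr : ∀ n, ContDiffAt ℝ n frameRight v := fun n => contDiffAt_frameRight hv.pos
  have hm : ∀ n, ContDiffAt ℝ n frameMid v := fun n => contDiffAt_frameMid hv.pos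
  have cadd : ∀ n, ContDiffAt ℝ n (fun w => w.1 + frameRight w) v := fun n =>
    contDiffAt_fst.add (hr n)
  have csub : ∀ n, ContDiffAt ℝ n (fun w => w.1 - frameRight w) v := fun n =>
    contDiffAt_fst.sub (hr n)
  have hT : ∀ n i j, ContDiffAt ℝ n (fun w => transportTime v w i j) v := fun n =>
    contDiffAt_rotation contDiffAt_const (cadd n) (by rw [fv.qL_add]; norm_num) hc.time
  have hTn : ∀ n, ContDiffAt ℝ n (fun w => (transportTime v w).mulVec (v.1 - frameRight v)) v :=
    fun n => contDiffAt_mulVec (hT n) contDiffAt_const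
  obtain ⟨s1, s2, -⟩ := transport_self_aux hv
  have hP : ∀ n i j, ContDiffAt ℝ n (fun w => transportPlane v w i j) v := fun n =>
    contDiffAt_matrix_mul (contDiffAt_rotation (hTn n) (csub n)
      (by rw [s1, Matrix.one_mulVec, fv.qL_sub]; norm_num) hc.plane) (hT n)
  have hPm : ∀ n, ContDiffAt ℝ n (fun w => (transportPlane v w).mulVec (frameMid v)) v :=
    fun n => contDiffAt_mulVec (hP n) contDiffAt_const
  refine ⟨fun n => contDiffAt_matrix_mul (contDiffAt_rotation (hPm n) (hm n)
    (by rw [s2, Matrix.one_mulVec, fv.mid]; norm_num) hc.mid) (hP n), ?_⟩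
  have c1 := ((contDiffAt_qL (n := 0) (contDiffAt_const (c := v.1 + frameRight v))).add
    (contDiffAt_bil (contDiffAt_const (c := v.1 + frameRight v))
      (cadd 0))).continuousAt.eventually_ne hc.time
  have c2 := ((contDiffAt_qL (hTn 0)).add
    (contDiffAt_bil (hTn 0) (csub 0))).continuousAt.eventually_ne hc.plane
  have c3 := ((contDiffAt_qL (hPm 0)).add
    (contDiffAt_bil (hPm 0) (hm 0))).continuousAt.eventually_ne hc.mid
  filter_upwards [c1, c2, c3] with w h1 h2 h3
  exact ⟨h1, h2, h3⟩

end Transport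

/-- Through every element of the group that maps the base jet to the jet of `x` there is a smooth
local section of the orbit map, defined near the velocity of `x`. -/
theorem exists_local_section {m : ℕ} (x : LiftedCurve m) {g₀ : SO m}
    (hg : g₀ • baseJet m = liftedJet x) :
    ∃ W : Set (Lor m × Lor m × Lor m), IsOpen W ∧ velocity x ∈ W ∧
      ∃ σ : Lor m × Lor m × Lor m → Idx m → Idx m → ℝ, ContDiffOn ℝ ∞ σ W ∧
        σ (velocity x) = (fun i j => mat g₀ i j) ∧
        ∀ y : LiftedCurve m, velocity y ∈ W →
          ∃ g : SO m, (fun i j => mat g i j) = σ (velocity y) ∧ g • baseJet m = liftedJet y := by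
  have hx := isVelocity_velocity x
  obtain ⟨hs, hclose⟩ := contDiffAt_transport hx
  have hself := (transport_self_aux hx).2.2
  have hdet : ∀ᶠ w in 𝓝 (velocity x), 0 < (transport (velocity x) w).det := by
    have h1 : ContinuousAt (fun w => transport (velocity x) w) (velocity x) :=
      continuousAt_pi.2 fun i => continuousAt_pi.2 fun j => (hs 0 i j).continuousAt
    have h2 : Continuous fun A : Matrix (Idx m) (Idx m) ℝ => A.det := continuous_id.matrix_det
    have h3 : ContinuousAt (fun w => (transport (velocity x) w).det) (velocity x) :=
      h2.continuousAt.comp h1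
    refine h3.eventually (lt_mem_nhds ?_)
    simp [hself]
  let σ : Lor m × Lor m × Lor m → Idx m → Idx m → ℝ := fun w i j =>
    (transport (velocity x) w * mat g₀) i j
  have hσ : ∀ᶠ w in 𝓝 (velocity x), ContDiffAt ℝ ∞ σ w := by
    -- Analyticity at a point spreads to a neighbourhood, whereas `ContDiffAt` of order `∞` at a
    -- single point need not.
    have h1 : ContDiffAt ℝ ω σ (velocity x) := contDiffAt_pi.2 fun i => contDiffAt_pi.2 fun j =>
      contDiffAt_matrix_mul (B := fun _ => mat g₀) (hs ω) (fun _ _ => contDiffAt_const) i j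
    exact (h1.eventually (by simp)).mono fun w hw => hw.of_le le_top
  obtain ⟨W, hW, hWo, hxW⟩ := mem_nhds_iff.1 ((hclose.and hdet).and hσ)
  refine ⟨W, hWo, hxW, σ, fun w hw => (hW hw).2.contDiffWithinAt, ?_, fun y hy => ?_⟩
  · funext i j
    simp only [σ, hself, one_mul]
  · obtain ⟨⟨hc, hd⟩, -⟩ := hW hy
    obtain ⟨hA, h0, h1, h2⟩ := isIsom_transport hx (isVelocity_velocity y) hc
    -- The determinant is `±1`, and `W` was chosen so that it is positive.
    have hd1 : (transport (velocity x) (velocity y)).det = 1 := by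
      rcases mul_self_eq_one_iff.1 ((sq _).symm.trans hA.det_sq) with h | h
      · exact h
      · linarith
    refine ⟨hA.toSO hd1 * g₀, rfl, ?_⟩
    rw [mul_smul, hg]
    exact smul_liftedJet_eq (a := 1) (b := 1) (c := 1) (by rw [one_smul]; exact h0)
      (by rw [one_smul]; exact h1) (by rw [one_smul]; exact h2)

/-! ### The stabilizer of the base jet -/

/-- The matrices that preserve the flag `⟨e₀⟩ ⊂ ⟨e₀, e₁⟩ ⊂ ⟨e₀, e₁, e_{m+2}⟩`. -/
def flagAlgebra (m : ℕ) : Subalgebra ℝ (Matrix (Idx m) (Idx m) ℝ) where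
  carrier := {A | (A (i1 m) (i0 m) = 0 ∧ A (iLast m) (i0 m) = 0 ∧ A (iLast m) (i1 m) = 0) ∧
    ∀ k : Fin m, A (iMid k) (i0 m) = 0 ∧ A (iMid k) (i1 m) = 0 ∧ A (iMid k) (iLast m) = 0}
  mul_mem' := by
    rintro A B ⟨⟨a1, a2, a3⟩, a4⟩ ⟨⟨b1, b2, b3⟩, b4⟩
    refine ⟨⟨?_, ?_, ?_⟩, fun k => ⟨?_, ?_, ?_⟩⟩ <;>
      simp [Matrix.mul_apply, a1, a2, a3, a4, b1, b2, b3, b4]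
  add_mem' := by
    rintro A B ⟨⟨a1, a2, a3⟩, a4⟩ ⟨⟨b1, b2, b3⟩, b4⟩
    refine ⟨⟨?_, ?_, ?_⟩, fun k => ⟨?_, ?_, ?_⟩⟩ <;>
      simp [a1, a2, a3, a4, b1, b2, b3, b4]
  algebraMap_mem' r := by
    refine ⟨⟨?_, ?_, ?_⟩, fun k => ⟨?_, ?_, ?_⟩⟩ <;> simp [Matrix.algebraMap_matrix_apply]

theorem isClosed_flagAlgebra (m : ℕ) : IsClosed (flagAlgebra m : Set (Matrix (Idx m) (Idx m) ℝ)) := by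
  have h : ∀ i j : Idx m, IsClosed {A : Matrix (Idx m) (Idx m) ℝ | A i j = 0} := fun i j =>
    isClosed_eq (continuous_id.matrix_elem i j) continuous_const
  have e : (flagAlgebra m : Set (Matrix (Idx m) (Idx m) ℝ)) =
      ({A | A (i1 m) (i0 m) = 0} ∩ ({A | A (iLast m) (i0 m) = 0} ∩ {A | A (iLast m) (i1 m) = 0})) ∩
      ⋂ k : Fin m, ({A | A (iMid k) (i0 m) = 0} ∩ ({A | A (iMid k) (i1 m) = 0} ∩
        {A | A (iMid k) (iLast m) = 0})) := by
    ext A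
    simp only [Set.mem_inter_iff, Set.mem_iInter]
    rfl
  rw [e]
  exact ((h _ _).inter ((h _ _).inter (h _ _))).inter
    (isClosed_iInter fun k => (h _ _).inter ((h _ _).inter (h _ _)))

theorem eq_zero_of_isLittleO_pow {a : ℝ} {n : ℕ}
    (h : (fun t : ℝ => a * t ^ n) =o[𝓝[≠] 0] fun t : ℝ => t ^ n) : a = 0 := by
  by_contra ha
  obtain ⟨t, ht, ht0⟩ := ((h.def (half_pos (abs_pos.2 ha))).and self_mem_nhdsWithin).exists
  rw [norm_mul, Real.norm_eq_abs a] at ht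
  have h1 : 0 < ‖t ^ n‖ := norm_pos_iff.2 (pow_ne_zero n ht0)
  have h2 := abs_pos.2 ha
  nlinarith

theorem eq_zero_of_quadratic_isLittleO {a b : ℝ}
    (h : (fun t : ℝ => t * a + t ^ 2 / 2 * b) =o[𝓝 0] fun t : ℝ => t ^ 2) : a = 0 ∧ b = 0 := by
  have h' := h.mono (nhdsWithin_le_nhds (s := {0}ᶜ))
  have o : (fun t : ℝ => t ^ 2) =o[𝓝[≠] 0] fun t : ℝ => t ^ 1 :=
    (Asymptotics.isLittleO_pow_pow (show 1 < 2 by norm_num)).mono nhdsWithin_le_nhds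
  have ha : a = 0 := by
    refine eq_zero_of_isLittleO_pow (n := 1) ?_
    refine ((h'.trans o).sub (o.const_mul_left (b / 2))).congr_left fun t => ?_
    ring
  refine ⟨ha, ?_⟩
  have hb : b / 2 = 0 := by
    refine eq_zero_of_isLittleO_pow (n := 2) (h'.congr_left fun t => ?_)
    rw [ha]
    ring
  linarith

theorem mulVec_baseLift {m : ℕ} (A : Matrix (Idx m) (Idx m) ℝ) (t : ℝ) (i : Idx m) :
    A.mulVec (baseLift m t) i = A i (i0 m) + t * A i (i1 m) + t ^ 2 / 2 * A i (iLast m) := by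
  simp [Matrix.mulVec, dotProduct, baseLift]
  ring

/-- At order zero, contact says that `g` preserves the line of `e₀`. Being an isometry, `g` then
preserves the hyperplane orthogonal to `e₀`, which contains `e₁`. Finally the middle coordinates of
the base lift vanish for every parameter and scale, so those of its image are `o(t²)`, which removes
the middle entries of the columns of `e₁` and `e_{m+2}`. -/
theorem mat_mem_flagAlgebra_of_mem_P2 {m : ℕ} {g : SO m} (hg : g ∈ P2 m) :
    mat g ∈ flagAlgebra m := by
  have hjet : (g • baseCurve m).jet = (baseCurve m).jet := hg
  obtain ⟨c₁, c₂, φ, h₁, h₂, hφ, ho⟩ : Contact _ _ := Quotient.exact hjet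
  obtain ⟨f₁, s₁, n₁, e₁⟩ := h₁.exists_factor ((baseLifted m).map g).2
  obtain ⟨f₂, -, -, e₂⟩ := h₂.exists_factor (baseLifted m).2
  change ∀ᶠ t in 𝓝 (0 : ℝ), c₁ t = f₁ t • (mat g).mulVec (baseLift m t) at e₁
  change ∀ᶠ t in 𝓝 (0 : ℝ), c₂ t = f₂ t • baseLift m t at e₂
  have hn : f₁ 0 ≠ 0 := n₁.self_of_nhds
  have hz : c₁ 0 = c₂ 0 := by
    have := (ho.def one_pos).self_of_nhds
    simpa [hφ.2.1, sub_eq_zero] using this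
  have h0 : ∀ i, f₁ 0 * mat g i (i0 m) = f₂ 0 * baseLift m 0 i := by
    intro i
    rw [e₁.self_of_nhds, e₂.self_of_nhds] at hz
    have := congrFun hz i
    simpa [mulVec_baseLift] using this
  have z1 : mat g (i1 m) (i0 m) = 0 := by simpa [baseLift, hn] using h0 (i1 m)
  have z2 : mat g (iLast m) (i0 m) = 0 := by simpa [baseLift, hn] using h0 (iLast m)
  have zk : ∀ k, mat g (iMid k) (i0 m) = 0 := fun k => by simpa [baseLift, hn] using h0 (iMid k)
  have z3 : mat g (iLast m) (i1 m) = 0 := by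
    have hd : (mat g).mulVec (e0 m) = mat g (i0 m) (i0 m) • e0 m := by
      funext i
      rcases i with ⟨⟩ | ⟨⟩ | k | ⟨⟩
      · simp [e0]
      · simpa [e0] using z1
      · simpa [e0] using zk k
      · simpa [e0] using z2
    have hne : mat g (i0 m) (i0 m) ≠ 0 := by
      intro h
      rw [h, zero_smul] at hd
      have := mat_injective g (hd.trans (by simp) : (mat g).mulVecLin (e0 m) = (mat g).mulVecLin 0)
      simpa [e0] using congrFun this (i0 m)
    have hb := (isIsom_mat g).bil_eq (e0 m) (e1 m)
    rw [hd, map_smul, LinearMap.smul_apply, bil_e0, bil_e0] at hb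
    simpa [e1, hne] using hb
  refine ⟨⟨z1, z2, z3⟩, fun k => ⟨zk k, ?_⟩⟩
  refine eq_zero_of_quadratic_isLittleO ?_
  have hk : (fun t => c₁ t (iMid k) - c₂ (φ t) (iMid k)) =o[𝓝 0] fun t : ℝ => t ^ 2 :=
    Asymptotics.isLittleO_pi.1 ho (iMid k)
  have hb : (fun t => (f₁ t)⁻¹) =O[𝓝 0] fun _ : ℝ => (1 : ℝ) :=
    (s₁.self_of_nhds.continuousAt.inv₀ hn).tendsto.isBigO_one ℝ
  refine (hb.mul_isLittleO hk).congr' ?_ (Eventually.of_forall fun t => one_mul _)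
  filter_upwards [e₁, hφ.tendsto.eventually e₂, n₁] with t u1 u2 u3
  rw [u1, u2, Pi.smul_apply, Pi.smul_apply, mulVec_baseLift, zk k]
  simp [baseLift, u3]

theorem mem_P2_of_mat_mem_flagAlgebra {m : ℕ} {g : SO m} (hg : mat g ∈ flagAlgebra m) :
    g ∈ P2 m := by
  obtain ⟨⟨z1, z2, z3⟩, zk⟩ := hg
  change g • liftedJet (baseLifted m) = liftedJet (baseLifted m)
  rw [← liftedJet_map]
  refine liftedJet_eq_of_velocity (l := mat g (i0 m) (i0 m)) (μ := mat g (i1 m) (i1 m))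
    (ν := mat g (i0 m) (i1 m)) (α := mat g (iLast m) (iLast m)) (β := mat g (i1 m) (iLast m))
    (δ := mat g (i0 m) (iLast m)) ?_ ?_ ?_
  all_goals
    rw [velocity_map, velocity_baseLifted]
    funext i
    rcases i with ⟨⟩ | ⟨⟩ | k | ⟨⟩ <;> simp [e0, e1, eLast, z1, z2, z3, zk]

theorem mem_P2_iff {m : ℕ} {g : SO m} : g ∈ P2 m ↔ mat g ∈ flagAlgebra m :=
  ⟨mat_mem_flagAlgebra_of_mem_P2, mem_P2_of_mat_mem_flagAlgebra⟩

theorem isInducing_mat (m : ℕ) : IsInducing (mat : SO m → Matrix (Idx m) (Idx m) ℝ) :=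
  IsInducing.subtypeVal.comp IsInducing.subtypeVal

theorem isClosed_P2 (m : ℕ) : IsClosed (P2 m : Set (SO m)) := by
  have : (P2 m : Set (SO m)) = mat ⁻¹' (flagAlgebra m : Set (Matrix (Idx m) (Idx m) ℝ)) := by
    ext g
    exact mem_P2_iff
  rw [this]
  exact (isClosed_flagAlgebra m).preimage (isInducing_mat m).continuous

/-! ### The Lie algebra of the stabilizer -/

theorem hasDerivAt_exp_mulVec {m : ℕ} (X : Matrix (Idx m) (Idx m) ℝ) (v : Lor m) (t : ℝ) :
    HasDerivAt (fun s : ℝ => (NormedSpace.exp (s • X)).mulVec v)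
      (X.mulVec ((NormedSpace.exp (t • X)).mulVec v)) t := by
  let _ : NormedRing (Matrix (Idx m) (Idx m) ℝ) := Matrix.linftyOpNormedRing
  let _ : NormedAlgebra ℝ (Matrix (Idx m) (Idx m) ℝ) := Matrix.linftyOpNormedAlgebra
  let L : Matrix (Idx m) (Idx m) ℝ →ₗ[ℝ] Lor m :=
    { toFun := fun A => A.mulVec v
      map_add' := fun A B => Matrix.add_mulVec A B v
      map_smul' := fun a A => Matrix.smul_mulVec a A v }
  have h := (LinearMap.toContinuousLinearMap L).hasFDerivAt.comp_hasDerivAt t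
    (hasDerivAt_exp_smul_const' (𝕂 := ℝ) X t)
  rw [Matrix.mulVec_mulVec]
  exact h

/-- The exponential of an infinitesimal isometry is an isometry. -/
theorem isIsom_exp {m : ℕ} {X : Matrix (Idx m) (Idx m) ℝ}
    (hX : ∀ v : Lor m, bil (X.mulVec v) v = 0) (t : ℝ) : IsIsom (NormedSpace.exp (t • X)) := by
  intro v
  have hd : ∀ s, HasDerivAt (fun s : ℝ => bil ((NormedSpace.exp (s • X)).mulVec v)
      ((NormedSpace.exp (s • X)).mulVec v)) 0 s := by
    intro s
    have h := hasDerivAt_exp_mulVec X v s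
    have h' := hasDerivAt_bil h h
    rwa [bil_comm _ (X.mulVec _), hX, add_zero] at h'
  have h := is_const_of_deriv_eq_zero (fun s => (hd s).differentiableAt)
    (fun s => (hd s).deriv) t 0
  simpa [bil_self] using h

theorem bil_mulVec_eq_zero_of_isIsom_exp {m : ℕ} {X : Matrix (Idx m) (Idx m) ℝ}
    (hX : ∀ t : ℝ, IsIsom (NormedSpace.exp (t • X))) (v w : Lor m) :
    bil (X.mulVec v) w + bil v (X.mulVec w) = 0 := by
  have h := hasDerivAt_bil (hasDerivAt_exp_mulVec X v 0) (hasDerivAt_exp_mulVec X w 0)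
  have h' : HasDerivAt (fun s : ℝ => bil ((NormedSpace.exp (s • X)).mulVec v)
      ((NormedSpace.exp (s • X)).mulVec w)) 0 0 :=
    (hasDerivAt_const (0 : ℝ) (bil v w)).congr_of_eventuallyEq
      (Eventually.of_forall fun s => (hX s).bil_eq v w)
  simpa using h.unique h'

/-- The exponential is the square of an isometry, whose determinant is `±1`. -/
theorem det_exp_smul {m : ℕ} {X : Matrix (Idx m) (Idx m) ℝ}
    (hX : ∀ t : ℝ, IsIsom (NormedSpace.exp (t • X))) (t : ℝ) :
    (NormedSpace.exp (t • X)).det = 1 := by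
  have h : t • X = (2 : ℕ) • ((t / 2) • X) := by
    rw [← Nat.cast_smul_eq_nsmul ℝ, smul_smul]
    congr 1
    push_cast
    ring
  rw [h, Matrix.exp_nsmul, Matrix.det_pow]
  exact (hX _).det_sq

theorem bil_p2Matrix {m : ℕ} (h y : ℝ) {r : Matrix (Fin m) (Fin m) ℝ} (hr : r.transpose = -r)
    (v : Lor m) : bil ((p2Matrix h y r).mulVec v) v = 0 := by
  have hs : ∑ k, (∑ j, r k j * v (iMid j)) * v (iMid k) = 0 := by
    have e : ∑ k, (∑ j, r k j * v (iMid j)) * v (iMid k) =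
        -∑ k, (∑ j, r k j * v (iMid j)) * v (iMid k) := by
      simp only [Finset.sum_mul]
      conv_lhs => rw [Finset.sum_comm]
      simp only [← Finset.sum_neg_distrib]
      refine Finset.sum_congr rfl fun j _ => Finset.sum_congr rfl fun k _ => ?_
      have := congrFun (congrFun hr j) k
      simp only [Matrix.transpose_apply, Matrix.neg_apply] at this
      rw [this]
      ring
    linarith
  rw [bil_apply]
  simp only [Matrix.mulVec, dotProduct, Fintype.sum_sum_type, Finset.univ_unique,
    Finset.sum_singleton, p2Matrix, zero_mul, Finset.sum_const_zero, add_zero, zero_add, hs]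
  ring

/-- The flag conditions are linear, so they pass to the derivative of the one-parameter group at
`0`, and the isometry property becomes skewness for `bil`; together they leave only `h`, `y`, `r`.
Conversely `flagAlgebra` is a closed subalgebra, hence stable under the exponential. -/
theorem lieAlgebraOf_P2 (m : ℕ) : lieAlgebraOf (P2 m) = p2 m := by
  ext X
  constructor
  · intro hX
    have hiso : ∀ t : ℝ, IsIsom (NormedSpace.exp (t • X)) := fun t => by
      obtain ⟨g, -, hg⟩ := hX t
      rw [← hg]
      exact isIsom_mat g
    have hflag : ∀ t : ℝ, NormedSpace.exp (t • X) ∈ flagAlgebra m := fun t => by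
      obtain ⟨g, hg, hge⟩ := hX t
      rw [← hge]
      exact mem_P2_iff.1 hg
    have hz : ∀ i j, (∀ A ∈ flagAlgebra m, A i j = 0) → X i j = 0 := by
      intro i j hij
      have h1 := hasDerivAt_pi.1 (hasDerivAt_exp_mulVec X (Pi.single j 1) 0) i
      have h2 := h1.unique ((hasDerivAt_const (0 : ℝ) (0 : ℝ)).congr_of_eventuallyEq
        (Eventually.of_forall fun s => by
          change (NormedSpace.exp (s • X)).mulVec (Pi.single j 1) i = 0
          rw [Matrix.mulVec_single_one, Matrix.col_apply, hij _ (hflag s)]))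
      rwa [zero_smul, NormedSpace.exp_zero, Matrix.one_mulVec, Matrix.mulVec_single_one] at h2
    have z1 : X (i1 m) (i0 m) = 0 := hz _ _ fun A hA => hA.1.1
    have z2 : X (iLast m) (i0 m) = 0 := hz _ _ fun A hA => hA.1.2.1
    have z3 : X (iLast m) (i1 m) = 0 := hz _ _ fun A hA => hA.1.2.2
    have z4 : ∀ k, X (iMid k) (i0 m) = 0 := fun k => hz _ _ fun A hA => (hA.2 k).1
    have z5 : ∀ k, X (iMid k) (i1 m) = 0 := fun k => hz _ _ fun A hA => (hA.2 k).2.1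
    have z6 : ∀ k, X (iMid k) (iLast m) = 0 := fun k => hz _ _ fun A hA => (hA.2 k).2.2
    have hs : ∀ i j, bil (X.col i) (Pi.single j 1) + bil (Pi.single i 1) (X.col j) = 0 := by
      intro i j
      have := bil_mulVec_eq_zero_of_isIsom_exp hiso (Pi.single i 1) (Pi.single j 1)
      rwa [Matrix.mulVec_single_one, Matrix.mulVec_single_one] at this
    simp only [bil_apply, Matrix.col_apply] at hs
    refine ⟨X (i0 m) (i0 m), X (i0 m) (i1 m), X.submatrix iMid iMid, ?_, ?_⟩
    · ext i j
      have := hs (iMid i) (iMid j)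
      simp [Pi.single_apply] at this
      simp only [Matrix.transpose_apply, Matrix.neg_apply, Matrix.submatrix_apply]
      linarith
    -- In turn, skewness gives: opposite corner entries `h, -h`; a zero at `(1, 1)`; the two equal
    -- entries `y`; a zero in the upper right corner; and, with `z4`, `z5`, `z6`, zeros in the rows
    -- of `e₀`, `e₁`, `e_{m+2}` under the middle columns.
    · have a1 := hs (i0 m) (iLast m)
      have a2 := hs (i1 m) (i1 m)
      have a3 := hs (i1 m) (iLast m)
      have a4 := hs (iLast m) (iLast m)
      have a5 := fun k => hs (iMid k) (iLast m)
      have a6 := fun k => hs (iMid k) (i1 m)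
      have a7 := fun k => hs (iMid k) (i0 m)
      simp [Pi.single_apply] at a1 a2 a3 a4 a5 a6 a7
      ext i j
      rcases i with ⟨⟩ | ⟨⟩ | i | ⟨⟩ <;> rcases j with ⟨⟩ | ⟨⟩ | j | ⟨⟩ <;>
        simp only [p2Matrix, Matrix.submatrix_apply]
      all_goals first
        | assumption
        | linarith
        | linarith [a5 j, z6 j]
        | linarith [a6 j, z5 j]
        | linarith [a7 j, z4 j]
        | linarith [z4 i]
        | linarith [z5 i]
        | linarith [z6 i]
  · rintro ⟨h, y, r, hr, rfl⟩ t
    have hiso := isIsom_exp (bil_p2Matrix h y hr)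
    refine ⟨(hiso t).toSO (det_exp_smul hiso t), mem_P2_iff.2 ?_, rfl⟩
    refine NormedSpace.exp_mem (R := ℝ) (isClosed_flagAlgebra m) (Subalgebra.smul_mem _ ?_ t)
    exact ⟨⟨rfl, rfl, rfl⟩, fun k => ⟨rfl, rfl, rfl⟩⟩

/-! ### The jet space as a homogeneous space -/

theorem isOpen_J2_iff {m : ℕ} {U : Set (J2 m)} :
    IsOpen U ↔ ∀ x, liftedJet x ∈ U → ∃ W, IsOpen W ∧ velocity x ∈ W ∧
      ∀ y, velocity y ∈ W → liftedJet y ∈ U := by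
  rw [isOpen_coinduced]
  refine Iff.trans isOpen_induced_iff ⟨?_, fun h => ?_⟩
  · rintro ⟨W, hW, e⟩ x hx
    have e' : ∀ y, velocity y ∈ W ↔ liftedJet y ∈ U := fun y => Set.ext_iff.1 e y
    exact ⟨W, hW, (e' x).2 hx, fun y => (e' y).1⟩
  · choose W hW hx hy using h
    refine ⟨⋃ x, ⋃ h, W x h, isOpen_iUnion fun x => isOpen_iUnion fun h => hW x h, ?_⟩
    ext y
    simp only [Set.mem_preimage, Set.mem_iUnion]
    exact ⟨fun ⟨x, h, hxy⟩ => hy x h y hxy, fun h => ⟨y, h, hx y h⟩⟩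

/-- The velocity of the image of the base curve under a matrix. -/
def matrixVelocity (m : ℕ) (A : Idx m → Idx m → ℝ) : Lor m × Lor m × Lor m :=
  (fun i => A i (i0 m), fun i => A i (i1 m), fun i => A i (iLast m))

theorem contDiff_matrixVelocity (m : ℕ) : ContDiff ℝ ∞ (matrixVelocity m) := by
  unfold matrixVelocity
  fun_prop

theorem velocity_map_baseLifted {m : ℕ} (g : SO m) :
    velocity ((baseLifted m).map g) = matrixVelocity m (fun i j => mat g i j) := by
  rw [velocity_map, velocity_baseLifted]
  simp only [e0, e1, eLast, Matrix.mulVec_single_one]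
  rfl

/-- The orbit map of the base jet on the homogeneous space. -/
noncomputable def orbitEquiv (m : ℕ) : (SO m ⧸ P2 m) ≃ J2 m :=
  Equiv.ofBijective (MulAction.ofQuotientStabilizer (SO m) (baseJet m))
    ⟨MulAction.injective_ofQuotientStabilizer (SO m) (baseJet m), fun z => by
      obtain ⟨γ, rfl⟩ := Quotient.exists_rep z
      obtain ⟨c, hc, -⟩ := γ.regular
      obtain ⟨g, hg⟩ := exists_smul_baseJet_eq (⟨(γ, c), hc⟩ : LiftedCurve m)
      exact ⟨(g : SO m ⧸ P2 m), hg⟩⟩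

theorem orbitEquiv_mk {m : ℕ} (g : SO m) :
    orbitEquiv m (g : SO m ⧸ P2 m) = g • baseJet m := rfl

theorem orbitEquiv_smul {m : ℕ} (g : SO m) (z : SO m ⧸ P2 m) :
    orbitEquiv m (g • z) = g • orbitEquiv m z :=
  MulAction.ofQuotientStabilizer_smul (SO m) (baseJet m) g z

theorem continuous_orbitEquiv (m : ℕ) : Continuous (orbitEquiv m) := by
  rw [(QuotientGroup.isQuotientMap_mk (P2 m)).continuous_iff]
  refine ⟨fun U hU => isOpen_iff_mem_nhds.2 fun g hg => ?_⟩
  obtain ⟨W, hW, hgW, hWU⟩ := isOpen_J2_iff.1 hU ((baseLifted m).map g) hg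
  have hc : Continuous fun g : SO m => velocity ((baseLifted m).map g) := by
    simp only [velocity_map_baseLifted]
    exact (contDiff_matrixVelocity m).continuous.comp (isInducing_mat m).continuous
  filter_upwards [(hW.preimage hc).mem_nhds hgW] with g' hg'
  exact hWU _ hg'

/-- A local section turns an open condition on matrices into an open condition on velocities. -/
theorem continuous_orbitEquiv_symm (m : ℕ) : Continuous (orbitEquiv m).symm := by
  refine ⟨fun U hU => isOpen_J2_iff.2 fun x hx => ?_⟩
  obtain ⟨g₀, hg₀⟩ := exists_smul_baseJet_eq x
  obtain ⟨W, hW, hxW, σ, hσ, hσx, hsec⟩ := exists_local_section x hg₀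
  obtain ⟨M, hM, hMU⟩ : ∃ M : Set (Idx m → Idx m → ℝ), IsOpen M ∧
      ∀ g : SO m, (fun i j => mat g i j) ∈ M ↔ (g : SO m ⧸ P2 m) ∈ U := by
    obtain ⟨M, hM, hMU⟩ :=
      (isInducing_mat m).isOpen_iff.1 (hU.preimage QuotientGroup.continuous_mk)
    exact ⟨M, hM, Set.ext_iff.1 hMU⟩
  have hmem : ∀ (g : SO m) (y : LiftedCurve m), g • baseJet m = liftedJet y →
      ((fun i j => mat g i j) ∈ M ↔ liftedJet y ∈ (orbitEquiv m).symm ⁻¹' U) := by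
    intro g y hgy
    rw [Set.mem_preimage, ← hgy, ← orbitEquiv_mk, Equiv.symm_apply_apply]
    exact hMU g
  refine ⟨W ∩ σ ⁻¹' M, hσ.continuousOn.isOpen_inter_preimage hW hM, ⟨hxW, ?_⟩, ?_⟩
  · rw [Set.mem_preimage, hσx]
    exact (hmem g₀ x hg₀).2 hx
  · rintro y ⟨hyW, hyM⟩
    obtain ⟨g, hg, hgy⟩ := hsec y hyW
    rw [Set.mem_preimage, ← hg] at hyM
    exact (hmem g y hgy).1 hyM

/-- A local smooth extension on velocities is composed with `matrixVelocity`; one on matrices is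
composed with a local section `σ`. -/
theorem smoothOn_iff_quotSmoothOn {m : ℕ} (U : Set (J2 m)) (f : J2 m → ℝ) :
    J2.SmoothOn U f ↔ quotSmoothOn (P2 m) (orbitEquiv m ⁻¹' U) (f ∘ orbitEquiv m) := by
  constructor
  · intro h g hg
    obtain ⟨W, hW, hgW, F, hF, hFf⟩ := h ((baseLifted m).map g) hg
    have hc := contDiff_matrixVelocity m
    refine ⟨matrixVelocity m ⁻¹' W, hW.preimage hc.continuous, ?_, F ∘ matrixVelocity m,
      hF.comp hc.contDiffOn (Set.mapsTo_preimage _ _), fun g' hg' hgW' => ?_⟩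
    · rw [Set.mem_preimage, ← velocity_map_baseLifted]
      exact hgW
    · rw [Set.mem_preimage, ← velocity_map_baseLifted] at hgW'
      rw [Function.comp_apply, ← velocity_map_baseLifted]
      exact hFf _ hg' hgW'
  · intro h x hx
    obtain ⟨g₀, hg₀⟩ := exists_smul_baseJet_eq x
    obtain ⟨W, hW, hxW, σ, hσ, hσx, hsec⟩ := exists_local_section x hg₀
    obtain ⟨M, hM, hgM, F, hF, hFf⟩ := h g₀ (by
      rw [Set.mem_preimage, orbitEquiv_mk, hg₀]
      exact hx)
    refine ⟨W ∩ σ ⁻¹' M, hσ.continuousOn.isOpen_inter_preimage hW hM, ⟨hxW, ?_⟩, F ∘ σ,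
      hF.comp (hσ.mono Set.inter_subset_left) fun v hv => hv.2, ?_⟩
    · rw [Set.mem_preimage, hσx]
      exact hgM
    · rintro y hyU ⟨hyW, hyM⟩
      obtain ⟨g, hg, hgy⟩ := hsec y hyW
      rw [Set.mem_preimage, ← hg] at hyM
      rw [Function.comp_apply, ← hg, ← hgy]
      refine hFf g ?_ hyM
      rw [Set.mem_preimage, orbitEquiv_mk, hgy]
      exact hyU

/-- The equivariant homeomorphism of the homogeneous space with the jet space. -/
noncomputable def orbitHomeomorph (m : ℕ) : (SO m ⧸ P2 m) ≃ₜ J2 m where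
  toEquiv := orbitEquiv m
  continuous_toFun := continuous_orbitEquiv m
  continuous_invFun := continuous_orbitEquiv_symm m

end ConformalJets

theorem proposition1 (m : ℕ) :
    IsClosed (ConformalJets.P2 m : Set (ConformalJets.SO m)) ∧
    ConformalJets.lieAlgebraOf (ConformalJets.P2 m) = ConformalJets.p2 m ∧
    ∃ Φ : (ConformalJets.SO m ⧸ ConformalJets.P2 m) ≃ₜ ConformalJets.J2 m,
      (∀ g : ConformalJets.SO m,
        Φ (g : ConformalJets.SO m ⧸ ConformalJets.P2 m) = g • ConformalJets.baseJet m) ∧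
      (∀ (g : ConformalJets.SO m) (z : ConformalJets.SO m ⧸ ConformalJets.P2 m),
        Φ (g • z) = g • Φ z) ∧
      ∀ (U : Set (ConformalJets.J2 m)) (f : ConformalJets.J2 m → ℝ), IsOpen U →
        (ConformalJets.J2.SmoothOn U f ↔
          ConformalJets.quotSmoothOn (ConformalJets.P2 m) (Φ ⁻¹' U) (f ∘ Φ)) :=
  ⟨ConformalJets.isClosed_P2 m, ConformalJets.lieAlgebraOf_P2 m, ConformalJets.orbitHomeomorph m,
    ConformalJets.orbitEquiv_mk, ConformalJets.orbitEquiv_smul,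
    fun U f _ => ConformalJets.smoothOn_iff_quotSmoothOn U f⟩
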